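/- Let $\{X_t\}_{t\ge 0}$ be a weakly stationary $q$-dimensional real process with (integrable) spectral density matrix $f$, i.e. $\mathbb E[(X_t-\mathbb EX_t)(X_{t+h}-\mathbb EX_{t+h})']=\int_{-\pi}^{\pi}e^{\mathrm i h\lambda}f(\lambda)\,d\lambda$ for all $t\ge 0$ and $h\in\mathbb Z$ with $t+h\ge 0$. Let $G_0=(G_0^{rs})$ be a real symmetric positive definite $q\times q$ matrix, let $\Theta\subseteq(-\tfrac12,\tfrac12)^q$ and $d_0=(d_1^0,\dots,d_q^0)\in\Theta$. Assume: * **A1.** For all $r,s$, as $\lambda\to0^+$, $f_{rs}(\lambda)=e^{\mathrm i\pi(d_r^0-d_s^0)/2}G_0^{rs}\lambda^{-d_r^0-d_s^0}+o(\lambda^{-d_r^0-d_s^0})$. * **A2.** $X_t-\mathbb EX_t=\sum_{k\ge0}A_k\varepsilon_{t-k}$ in mean square, with real matrices $A_k$, $\sum_k\|A_k\|_\infty^2<\infty$, where $\{\varepsilon_t\}_{t\in\mathbb Z}$ is square integrable with $\mathbb E(\varepsilon_t\mid\mathscr F_{t-1})=0$ and $\mathbb E(\varepsilon_t\varepsilon_t'\mid\mathscr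 F_{t-1})=I_q$ a.s., $\mathscr F_t=\sigma(\varepsilon_s,\,s\le t)$; moreover there are a random variable $\xi$ with $\mathbb E\xi^2<\infty$ and a constant $K>0$ with $\mathbb P(\|\varepsilon_t\|_\infty^2>\eta)\le K\,\mathbb P(\xi^2>\eta)$ for all $t$ and all $\eta>0$. * **A3.** For some $\delta>0$, the series $A(\lambda)=\sum_{k\ge0}A_ke^{\mathrm ik\lambda}$ converges on $(0,\delta)$ to a differentiable function, and for each $r$ the $r$-th row of its conjugate transpose satisfies $\frac{\partial}{\partial\lambda}(A(\lambda)^*)_{r\cdot}=O\big(\lambda^{-1}\|(A(\lambda)^*)_{r\cdot}\|_\infty\big)$ as $\lambda\to0^+$. * **A4.** $m=m(n)\in\mathbb N$ satisfies $1/m+m/n\to0$ as $n\to\infty$. Put $\lambda_j=2\pi j/n$. Let $f_n=(f_n^{rs})$ be an estimator of $f$, i.e. a $q\times q$ complex matrix-valued function of the frequency computed from the observations $X_1,\dots,X_n$, such that with probability tending to one the matrices $f_n(\lambda_j)$, $1\le j\le m$, are all Hermitian positive semidefinite. Assume that $f_n$ satisfies, for $1\le u<v\le m$ (where $u=u_n$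 and $v=v_n$ may depend on $n$), $$\max_{r,s}\bigg|\frac1m\sum_{j=u}^{v}\Big(e^{\mathrm i(\lambda_j-\pi)(d_r^0-d_s^0)/2}\lambda_j^{d_r^0+d_s^0}f_n^{rs}(\lambda_j)-G_0^{rs}\Big)\bigg|=o_{\mathbb P}(1)\qquad(n\to\infty).$$ Define $$\widehat G(d)=\frac1m\sum_{j=1}^m\mathrm{Re}\Big[\mathrm{diag}_i\{\lambda_j^{d_i}\}\,f_n(\lambda_j)\,\mathrm{diag}_i\{\lambda_j^{d_i}\}\Big],\qquad S(d)=\log\det\widehat G(d)-2\sum_{k=1}^qd_k\,\frac1m\sum_{j=1}^m\log\lambda_j$$ (with $\log x=-\infty$ for $x\le 0$), and let $\widehat d=\widehat d_n$ be a minimiser of $S$ over $\Theta$ (almost surely, for all large $n$). Then $\widehat d\to d_0$ in probability as $n\to\infty$. -/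

import Mathlib

open MeasureTheory Filter Topology Asymptotics

noncomputable section

namespace LongMemory

variable {Ω : Type*} [MeasurableSpace Ω] {q : ℕ}

/-- The Fourier frequency `λ_j = 2πj/n` for the sample size `n`. -/
def fourierFreq (n j : ℕ) : ℝ := 2 * Real.pi * j / n

/-- Weak (second order) stationarity of a `q`-dimensional process `X_0, X_1, …`. -/
structure IsWeaklyStationary (μ : Measure Ω) (X : ℕ → Ω → Fin q → ℝ) : Prop where
  memLp : ∀ t r, MemLp (fun ω => X t ω r) 2 μ
  mean_eq : ∀ t r, ∫ ω, X t ω r ∂μ = ∫ ω, X 0 ω r ∂μ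
  cov_eq : ∀ t h r s,
    ProbabilityTheory.covariance (fun ω => X t ω r) (fun ω => X (t + h) ω s) μ
      = ProbabilityTheory.covariance (fun ω => X 0 ω r) (fun ω => X h ω s) μ

/-- `f` is the spectral density matrix function of `X`: it is integrable on `(-π, π]` and
`E[(X_t - E X_t)(X_{t+h} - E X_{t+h})'] = ∫_{-π}^{π} e^{ihλ} f(λ) dλ` for every lag `h ∈ ℤ` with
`t + h ≥ 0`; below `t' = t + h`. -/
structure IsSpectralDensity (μ : Measure Ω) (X : ℕ → Ω → Fin q → ℝ)
    (f : ℝ → Matrix (Fin q) (Fin q) ℂ) : Prop where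
  integrable : ∀ r s, IntervalIntegrable (fun x => f x r s) volume (-Real.pi) Real.pi
  cov_eq : ∀ (t t' : ℕ) (r s : Fin q),
    ((ProbabilityTheory.covariance (fun ω => X t ω r) (fun ω => X t' ω s) μ : ℝ) : ℂ)
      = ∫ x in (-Real.pi)..Real.pi,
          Complex.exp (Complex.I * (((t' : ℝ) - (t : ℝ)) * x : ℝ)) * f x r s

/-- Local behaviour of the spectral density matrix at the origin: for all `r, s`, as `λ → 0+`,
`f_{rs}(λ) = e^{iπ(d_r - d_s)/2} G_{rs} λ^{-d_r-d_s} + o(λ^{-d_r-d_s})`. -/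
def AssumptionA1 (f : ℝ → Matrix (Fin q) (Fin q) ℂ) (d₀ : Fin q → ℝ)
    (G₀ : Matrix (Fin q) (Fin q) ℝ) : Prop :=
  ∀ r s, (fun x : ℝ => f x r s
      - Complex.exp (Complex.I * (Real.pi * (d₀ r - d₀ s) / 2 : ℝ)) * (G₀ r s : ℂ)
          * ((x ^ (-d₀ r - d₀ s) : ℝ) : ℂ))
    =o[𝓝[>] (0 : ℝ)] (fun x : ℝ => x ^ (-d₀ r - d₀ s))

/-- The σ-field `ℱ_t` generated by `ε_s`, `s ≤ t`. -/
abbrev pastSigma (ε : ℤ → Ω → Fin q → ℝ) (t : ℤ) : MeasurableSpace Ω :=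
  ⨆ s : ℤ, ⨆ _ : s ≤ t, MeasurableSpace.comap (ε s) inferInstance

/-- `X` is the causal linear process `X_t - E X_t = ∑_{k ≥ 0} A_k ε_{t-k}` (the series converges
in mean square) with `∑_k ‖A_k‖_∞² < ∞`, driven by a square integrable martingale difference
sequence with conditional covariance matrix the identity, whose sup-norm is uniformly dominated in
probability by a square integrable random variable. -/
structure AssumptionA2 (μ : Measure Ω) (X : ℕ → Ω → Fin q → ℝ)
    (A : ℕ → Matrix (Fin q) (Fin q) ℝ) (ε : ℤ → Ω → Fin q → ℝ) : Prop where
  summable_sq : Summable (fun k => (⨆ r, ⨆ s, |A k r s|) ^ 2)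
  measurable : ∀ t, Measurable (ε t)
  memLp : ∀ t r, MemLp (fun ω => ε t ω r) 2 μ
  linear : ∀ (t : ℕ) (r : Fin q), Tendsto
    (fun N : ℕ => eLpNorm (fun ω => (X t ω r - ∫ ω', X t ω' r ∂μ)
      - ∑ k ∈ Finset.range N, (A k).mulVec (ε ((t : ℤ) - k) ω) r) 2 μ) atTop (𝓝 0)
  martingale_diff : ∀ t r,
    μ[fun ω => ε t ω r | pastSigma ε (t - 1)] =ᵐ[μ] fun _ => (0 : ℝ)
  cond_cov : ∀ t r s,
    μ[fun ω => ε t ω r * ε t ω s | pastSigma ε (t - 1)] =ᵐ[μ]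
      fun _ => (1 : Matrix (Fin q) (Fin q) ℝ) r s
  dominated : ∃ (ξ : Ω → ℝ) (K : ℝ), 0 < K ∧ MemLp ξ 2 μ ∧
    ∀ (t : ℤ) (η : ℝ), 0 < η →
      μ {ω | η < ‖ε t ω‖ ^ 2} ≤ ENNReal.ofReal K * μ {ω | η < ξ ω ^ 2}

/-- On a right neighbourhood `(0, δ)` of the origin the (possibly only conditionally convergent)
series `T(λ) = ∑_{k ≥ 0} A_k e^{ikλ}` converges to a differentiable function, and each row of its
conjugate transpose satisfies `∂/∂λ (T(λ)ᴴ)_{r·} = O(λ⁻¹ ‖(T(λ)ᴴ)_{r·}‖_∞)` as `λ → 0+`. -/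
def AssumptionA3 (A : ℕ → Matrix (Fin q) (Fin q) ℝ) : Prop :=
  ∃ (T : ℝ → Matrix (Fin q) (Fin q) ℂ) (δ : ℝ), 0 < δ ∧
    (∀ x ∈ Set.Ioo 0 δ, ∀ r s, Tendsto
      (fun N : ℕ => ∑ k ∈ Finset.range N,
        (A k r s : ℂ) * Complex.exp (Complex.I * ((k : ℝ) * x : ℝ)))
      atTop (𝓝 (T x r s))) ∧
    (∀ x ∈ Set.Ioo 0 δ, ∀ r s, DifferentiableAt ℝ (fun y => T y r s) x) ∧
    (∀ r : Fin q, (fun x : ℝ => deriv (fun y : ℝ => fun s : Fin q => (T y).conjTranspose r s) x)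
      =O[𝓝[>] (0 : ℝ)] (fun x : ℝ => x⁻¹ * ‖fun s : Fin q => (T x).conjTranspose r s‖))

/-- `1/m + m/n → 0` as `n → ∞`, that is, `m → ∞` and `m/n → 0`. -/
def AssumptionA4 (m : ℕ → ℕ) : Prop :=
  Tendsto m atTop atTop ∧ Tendsto (fun n : ℕ => (m n : ℝ) / (n : ℝ)) atTop (𝓝 0)

/-- A spectral density estimator: for every sample size `n`, a function that turns the observations
`x_1, …, x_n` into a matrix-valued function of the frequency. -/
abbrev SpectralEstimator (q : ℕ) : Type :=
  (n : ℕ) → (Fin n → Fin q → ℝ) → ℝ → Matrix (Fin q) (Fin q) ℂ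

/-- The random function `f_n` obtained from the observations `X_1, …, X_n`. -/
def evalEstimator (est : SpectralEstimator q) (X : ℕ → Ω → Fin q → ℝ) (n : ℕ) (ω : Ω) :
    ℝ → Matrix (Fin q) (Fin q) ℂ :=
  est n (fun i => X ((i : ℕ) + 1) ω)

open scoped ComplexOrder in
/-- With probability tending to one, `f_n(λ_j)` is Hermitian positive semidefinite for all
`1 ≤ j ≤ m`. -/
def IsAsymptoticallyPosSemidef (μ : Measure Ω) (fn : ℕ → Ω → ℝ → Matrix (Fin q) (Fin q) ℂ)
    (m : ℕ → ℕ) : Prop :=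
  Tendsto (fun n : ℕ => μ {ω | ¬ ∀ j ∈ Finset.Icc 1 (m n),
    (fn n ω (fourierFreq n j)).PosSemidef}) atTop (𝓝 0)

/-- The normalised entry `e^{i(λ_j-π)(d_r-d_s)/2} λ_j^{d_r+d_s} F_{rs}`. -/
def normalizedEntry (d : Fin q → ℝ) (n j : ℕ) (F : Matrix (Fin q) (Fin q) ℂ) (r s : Fin q) : ℂ :=
  Complex.exp (Complex.I * ((fourierFreq n j - Real.pi) * (d r - d s) / 2 : ℝ))
    * ((fourierFreq n j ^ (d r + d s) : ℝ) : ℂ) * F r s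

/-- The averaged condition on `f_n`: for `1 ≤ u < v ≤ m` (both may vary with `n`) and all `r, s`,
`(1/m) ∑_{j=u}^{v} (e^{i(λ_j-π)(d_r-d_s)/2} λ_j^{d_r+d_s} f_n^{rs}(λ_j) - G_{rs}) = o_P(1)`. -/
def AveragedCondition (μ : Measure Ω) (fn : ℕ → Ω → ℝ → Matrix (Fin q) (Fin q) ℂ)
    (m : ℕ → ℕ) (d₀ : Fin q → ℝ) (G₀ : Matrix (Fin q) (Fin q) ℝ) : Prop :=
  ∀ u v : ℕ → ℕ, (∀ᶠ n in atTop, 1 ≤ u n ∧ u n < v n ∧ v n ≤ m n) →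
    ∀ r s : Fin q, TendstoInMeasure μ
      (fun (n : ℕ) (ω : Ω) => (1 / (m n : ℂ)) * ∑ j ∈ Finset.Icc (u n) (v n),
        (normalizedEntry d₀ n j (fn n ω (fourierFreq n j)) r s - (G₀ r s : ℂ)))
      atTop (fun _ => (0 : ℂ))

/-- `Ĝ(d) = (1/m) ∑_{j=1}^m Re[diag(λ_j^{d_i}) F(λ_j) diag(λ_j^{d_i})]`. -/
def Ghat (n m : ℕ) (F : ℝ → Matrix (Fin q) (Fin q) ℂ) (d : Fin q → ℝ) :
    Matrix (Fin q) (Fin q) ℝ :=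
  (1 / (m : ℝ)) • ∑ j ∈ Finset.Icc 1 m,
    (Matrix.diagonal (fun i => ((fourierFreq n j ^ d i : ℝ) : ℂ)) * F (fourierFreq n j)
      * Matrix.diagonal (fun i => ((fourierFreq n j ^ d i : ℝ) : ℂ))).map Complex.re

/-- The objective function `S(d) = log det Ĝ(d) - 2 ∑_k d_k (1/m) ∑_{j=1}^m log λ_j`, with values
in the extended reals so that `log 0 = -∞`. -/
def objective (n m : ℕ) (F : ℝ → Matrix (Fin q) (Fin q) ℂ) (d : Fin q → ℝ) : EReal :=
  ENNReal.log (ENNReal.ofReal (Ghat n m F d).det)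
    - ((2 * ∑ k, d k * ((1 / (m : ℝ)) * ∑ j ∈ Finset.Icc 1 m, Real.log (fourierFreq n j)) : ℝ)
        : EReal)

/-- `d̂_n` is (almost surely, for all large `n`) a minimiser of the objective function over `Θ`. -/
def IsArgminEstimator (μ : Measure Ω) (fn : ℕ → Ω → ℝ → Matrix (Fin q) (Fin q) ℂ)
    (m : ℕ → ℕ) (Θ : Set (Fin q → ℝ)) (dhat : ℕ → Ω → Fin q → ℝ) : Prop :=
  ∀ᶠ n in atTop, ∀ᵐ ω ∂μ, dhat n ω ∈ Θ ∧
    ∀ d ∈ Θ, objective n (m n) (fn n ω) (dhat n ω) ≤ objective n (m n) (fn n ω) d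

end LongMemory

end

/-!
Write `θ = d - d₀` and let `W_j` be the real positive semidefinite matrix
`Re[diag(λ_j^{d₀}) f_n(λ_j) diag(λ_j^{d₀})]`. Taking the powers of `λ_m` out of `Ĝ(d)` leaves
`H(θ) = (1/m) ∑ diag((j/m)^θ) W_j diag((j/m)^θ)`, and minimality of `d̂` against `d₀` becomes
`det H(θ̂) ≤ det Ĝ(d₀) · exp(2 ∑ θ̂_k (1/m) ∑ log(j/m))`, where the averages of `log(j/m)` tend
to `-1`.

Convergence in probability to a constant is convergence along the filter `probFilter`, so the
argument is deterministic along a filter, and by compactness of `[-1/2, 1/2]^q` along an ultrafilter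
on which `θ̂ → θ*`. Since `θ*_r ≤ -1/2` is possible, the sum in `H` is cut at `j > κm`; this only
decreases the determinant (`det_le_det_add`), because the `W_j` are positive semidefinite. The
averaged condition says that block averages of `W_j` converge to `Ω_{rs} = cos(π(d_r-d_s)/2) G_{rs}`,
which is positive definite (`limitMatrix_posDef`), so the truncated `H` tends to the Hadamard product
of `Ω` with the moment matrix `∫_κ^1 x^{θ*_r+θ*_s} dx` (`tendsto_average_mul_tendstoUniformlyOn`).
Oppenheim's inequality (`det_mul_prod_diag_le_det_hadamard`) bounds the determinant of the product
below by `det Ω ∏_r ∫_κ^1 x^{2θ*_r} dx`. Altogether `∏_r e^{2θ*_r} ∫_κ^1 x^{2θ*_r} dx ≤ 1` for every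
`κ`. As `κ → 0` the factors tend to `e^{2θ*_r} / (1 + 2θ*_r)`, or to infinity, and all of these are
larger than one unless `θ*_r = 0`; hence `θ* = 0` (`eq_zero_of_prod_integral_rpow_le_one`).
-/

namespace LongMemory

/-! ### Determinant inequalities for positive semidefinite matrices -/

section determinants

open Matrix

/-- The spectral theorem for a real symmetric matrix, written with an orthogonal matrix. -/
theorem exists_orthogonal_diagonalization {q : ℕ} {A : Matrix (Fin q) (Fin q) ℝ}
    (hA : A.IsHermitian) : ∃ U : Matrix (Fin q) (Fin q) ℝ, U * Uᵀ = 1 ∧ Uᵀ * U = 1 ∧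
      A = U * diagonal hA.eigenvalues * Uᵀ := by
  have h := hA.spectral_theorem
  rw [Unitary.conjStarAlgAut_apply] at h
  refine ⟨hA.eigenvectorUnitary.1, ?_, ?_, ?_⟩
  · exact Unitary.coe_mul_star_self hA.eigenvectorUnitary
  · exact Unitary.coe_star_mul_self hA.eigenvectorUnitary
  · exact h

theorem one_le_det_one_add {q : ℕ} {P : Matrix (Fin q) (Fin q) ℝ} (hP : P.PosSemidef) :
    1 ≤ (1 + P).det := by
  obtain ⟨U, hU, hU', h⟩ := exists_orthogonal_diagonalization hP.1
  have h2 : 1 + P = U * diagonal (fun i => 1 + hP.1.eigenvalues i) * Uᵀ := by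
    have h4 : diagonal (fun i => 1 + hP.1.eigenvalues i) = 1 + diagonal hP.1.eigenvalues := by
      rw [← diagonal_one, diagonal_add]
    rw [h4, mul_add, add_mul, mul_one, hU, ← h]
  have h3 : U.det * Uᵀ.det = 1 := by rw [← det_mul, hU, det_one]
  rw [h2, det_mul, det_mul, det_diagonal, mul_right_comm, h3, one_mul]
  calc (1 : ℝ) = ∏ _i : Fin q, 1 := by simp
    _ ≤ _ := Finset.prod_le_prod (fun _ _ => zero_le_one)
      fun i _ => by linarith [hP.eigenvalues_nonneg i]

theorem exists_eq_transpose_mul_self {q : ℕ} {A : Matrix (Fin q) (Fin q) ℝ}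
    (hA : A.PosSemidef) : ∃ C : Matrix (Fin q) (Fin q) ℝ, A = Cᵀ * C := by
  obtain ⟨U, -, -, h⟩ := exists_orthogonal_diagonalization hA.1
  refine ⟨diagonal (fun i => √(hA.1.eigenvalues i)) * Uᵀ, ?_⟩
  have h2 : diagonal hA.1.eigenvalues
      = diagonal (fun i => √(hA.1.eigenvalues i)) * diagonal (fun i => √(hA.1.eigenvalues i)) := by
    rw [diagonal_mul_diagonal]
    congr 1
    funext i
    exact (Real.mul_self_sqrt (hA.eigenvalues_nonneg i)).symm
  rw [h2] at h
  rw [transpose_mul, transpose_transpose, diagonal_transpose]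
  simpa only [Matrix.mul_assoc] using h

/-- The determinant is monotone for the Loewner order. -/
theorem det_le_det_add {q : ℕ} {A P : Matrix (Fin q) (Fin q) ℝ} (hA : A.PosSemidef)
    (hP : P.PosSemidef) : A.det ≤ (A + P).det := by
  rcases hA.det_nonneg.eq_or_lt with h0 | hpos
  · rw [← h0]; exact (hA.add hP).det_nonneg
  · obtain ⟨C, rfl⟩ := exists_eq_transpose_mul_self hA
    have hC : IsUnit C.det := by
      rw [isUnit_iff_ne_zero]
      rintro h
      simp [h] at hpos
    have hC' : IsUnit Cᵀ.det := by rwa [det_transpose]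
    have hP' : ((C⁻¹)ᵀ * P * C⁻¹).PosSemidef := by
      simpa using hP.conjTranspose_mul_mul_same C⁻¹
    have h : Cᵀ * C + P = Cᵀ * (1 + (C⁻¹)ᵀ * P * C⁻¹) * C := by
      rw [mul_add, add_mul, mul_one, transpose_nonsing_inv]
      congr 1
      rw [Matrix.mul_assoc, Matrix.mul_assoc, Matrix.nonsing_inv_mul _ hC, Matrix.mul_one,
        ← Matrix.mul_assoc, Matrix.mul_nonsing_inv _ hC', Matrix.one_mul]
    have h1 := one_le_det_one_add hP'
    rw [h, det_mul, det_mul, det_mul]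
    rw [det_mul] at hpos
    nlinarith

/-- If `∑ Kₗᵀ Kₗ = ∑ Kₗ Kₗᵀ = 1`, the map `A ↦ ∑ Kₗᵀ A Kₗ` does not decrease the determinant of a
positive definite matrix: its output has as eigenvalues averages of those of `A` with doubly
stochastic weights. -/
theorem det_le_det_sum_transpose_mul_mul {q : ℕ} {κ : Type*} [Fintype κ]
    {A : Matrix (Fin q) (Fin q) ℝ}
    (hA : A.PosDef) (K : κ → Matrix (Fin q) (Fin q) ℝ) (h₁ : ∑ l, (K l)ᵀ * K l = 1)
    (h₂ : ∑ l, K l * (K l)ᵀ = 1) : A.det ≤ (∑ l, (K l)ᵀ * A * K l).det := by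
  set S := ∑ l, (K l)ᵀ * A * K l with hS
  have hSpsd : S.PosSemidef := by
    refine posSemidef_sum _ fun l _ => ?_
    simpa using hA.posSemidef.conjTranspose_mul_mul_same (K l)
  obtain ⟨V, hVV, hVV', hA2⟩ := exists_orthogonal_diagonalization hA.1
  obtain ⟨U, hUU, hUU', hS1⟩ := exists_orthogonal_diagonalization hSpsd.1
  set γ := hA.1.eigenvalues
  set ν := hSpsd.1.eigenvalues
  have hS2 : Uᵀ * S * U = diagonal ν := by
    rw [hS1]
    calc _ = (Uᵀ * U) * diagonal ν * (Uᵀ * U) := by simp only [Matrix.mul_assoc]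
      _ = _ := by rw [hUU', Matrix.one_mul, Matrix.mul_one]
  set Q : κ → Matrix (Fin q) (Fin q) ℝ := fun l => Vᵀ * K l * U
  have hQ1 : ∑ l, (Q l)ᵀ * Q l = 1 := by
    have : ∀ l, (Q l)ᵀ * Q l = Uᵀ * ((K l)ᵀ * K l) * U := fun l => by
      simp only [Q, transpose_mul, transpose_transpose]
      calc _ = Uᵀ * ((K l)ᵀ * ((V * Vᵀ) * K l)) * U := by simp only [Matrix.mul_assoc]
        _ = _ := by rw [hVV, Matrix.one_mul]
    simp only [this]
    rw [← Finset.sum_mul, ← Finset.mul_sum, h₁, Matrix.mul_one, hUU']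
  have hQ2 : ∑ l, Q l * (Q l)ᵀ = 1 := by
    have : ∀ l, Q l * (Q l)ᵀ = Vᵀ * (K l * (K l)ᵀ) * V := fun l => by
      simp only [Q, transpose_mul, transpose_transpose]
      calc _ = Vᵀ * (K l * ((U * Uᵀ) * (K l)ᵀ)) * V := by simp only [Matrix.mul_assoc]
        _ = _ := by rw [hUU, Matrix.one_mul]
    simp only [this]
    rw [← Finset.sum_mul, ← Finset.mul_sum, h₂, Matrix.mul_one, hVV']
  have hQ3 : ∑ l, (Q l)ᵀ * diagonal γ * Q l = diagonal ν := by
    have : ∀ l, (Q l)ᵀ * diagonal γ * Q l = Uᵀ * ((K l)ᵀ * A * K l) * U := fun l => by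
      rw [hA2]
      simp only [Q, transpose_mul, transpose_transpose, Matrix.mul_assoc]
    simp only [this]
    rw [← Finset.sum_mul, ← Finset.mul_sum, ← hS2]
  set P : Fin q → Fin q → ℝ := fun i k => ∑ l, Q l k i ^ 2
  have hP0 : ∀ i k, 0 ≤ P i k := fun i k => Finset.sum_nonneg fun _ _ => sq_nonneg _
  have hPr : ∀ i, ∑ k, P i k = 1 := fun i => by
    have := congrFun (congrFun hQ1 i) i
    simp only [Matrix.sum_apply, Matrix.mul_apply, transpose_apply, one_apply_eq] at this
    rw [Finset.sum_comm] at this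
    simpa [P, sq] using this
  have hPc : ∀ k, ∑ i, P i k = 1 := fun i => by
    have := congrFun (congrFun hQ2 i) i
    simp only [Matrix.sum_apply, Matrix.mul_apply, transpose_apply, one_apply_eq] at this
    rw [Finset.sum_comm] at this
    simpa [P, sq] using this
  have hν : ∀ i, ν i = ∑ k, P i k * γ k := fun i => by
    have := congrFun (congrFun hQ3 i) i
    simp only [Matrix.sum_apply, Matrix.mul_apply (M := _ * diagonal γ), transpose_apply,
      mul_diagonal, diagonal_apply_eq] at this
    rw [← this, Finset.sum_comm]
    refine Finset.sum_congr rfl fun k _ => ?_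
    simp only [P, Finset.sum_mul]
    exact Finset.sum_congr rfl fun l _ => by ring
  have hγ : ∀ k, 0 < γ k := hA.eigenvalues_pos
  have hdA : A.det = ∏ k, γ k := hA.1.det_eq_prod_eigenvalues
  have hdS : S.det = ∏ k, ν k := hSpsd.1.det_eq_prod_eigenvalues
  calc A.det = ∏ k, ∏ i, γ k ^ P i k := by
        rw [hdA]
        refine Finset.prod_congr rfl fun k _ => ?_
        rw [← Real.rpow_sum_of_pos (hγ k), hPc, Real.rpow_one]
    _ = ∏ i, ∏ k, γ k ^ P i k := Finset.prod_comm
    _ ≤ ∏ i, ν i := by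
        refine Finset.prod_le_prod
          (fun i _ => Finset.prod_nonneg fun k _ => Real.rpow_nonneg (hγ k).le _) fun i _ => ?_
        rw [hν]
        exact Real.geom_mean_le_arith_mean_weighted _ _ _ (fun k _ => hP0 i k) (hPr i)
          fun k _ => (hγ k).le
    _ = S.det := hdS.symm

/-- **Oppenheim's inequality** for a second factor with unit diagonal. -/
theorem det_le_det_hadamard {q : ℕ} {A B : Matrix (Fin q) (Fin q) ℝ} (hA : A.PosDef)
    (hB : B.PosSemidef) (h1 : ∀ i, B i i = 1) :
    A.det ≤ (of fun r s => A r s * B r s).det := by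
  obtain ⟨C, rfl⟩ := exists_eq_transpose_mul_self hB
  simp only [mul_apply, transpose_apply] at h1
  have hD : ∑ l, diagonal (C l) * diagonal (C l) = 1 := by
    ext r s
    simp only [diagonal_mul_diagonal, Matrix.sum_apply]
    rcases eq_or_ne r s with rfl | h
    · simpa using h1 r
    · simp [h]
  have h := det_le_det_sum_transpose_mul_mul hA (fun l => diagonal (C l))
    (by simpa only [diagonal_transpose] using hD) (by simpa only [diagonal_transpose] using hD)
  convert h using 2
  ext r s
  simp only [of_apply, mul_apply (M := Cᵀ), transpose_apply, Matrix.sum_apply, diagonal_transpose,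
    mul_diagonal, diagonal_mul, Finset.mul_sum]
  exact Finset.sum_congr rfl fun l _ => by ring

/-- **Oppenheim's inequality**: `det A * ∏ Bᵢᵢ ≤ det (A ⊙ B)`. -/
theorem det_mul_prod_diag_le_det_hadamard {q : ℕ} {A B : Matrix (Fin q) (Fin q) ℝ}
    (hA : A.PosDef) (hB : B.PosSemidef) (hpos : ∀ i, 0 < B i i) :
    A.det * ∏ i, B i i ≤ (of fun r s => A r s * B r s).det := by
  set c : Fin q → ℝ := fun i => √(B i i) with hc
  have hc0 : ∀ i, 0 < c i := fun i => Real.sqrt_pos.2 (hpos i)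
  have hcc : ∀ i, c i * c i = B i i := fun i => Real.mul_self_sqrt (hpos i).le
  have h1 : (diagonal (fun i => (c i)⁻¹) * B * diagonal fun i => (c i)⁻¹).PosSemidef := by
    have := hB.conjTranspose_mul_mul_same (diagonal fun i => (c i)⁻¹)
    simpa [diagonal_conjTranspose] using this
  have h2 := det_le_det_hadamard hA h1 fun i => by
    rw [mul_diagonal, diagonal_mul, ← hcc]
    have := (hc0 i).ne'
    field_simp
  have h3 : (of fun r s => A r s * B r s) = diagonal c * (of fun r s => A r s *
      (diagonal (fun i => (c i)⁻¹) * B * diagonal fun i => (c i)⁻¹) r s) * diagonal c := by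
    ext r s
    simp only [mul_diagonal, diagonal_mul, of_apply]
    have := (hc0 r).ne'
    have := (hc0 s).ne'
    field_simp
  have h4 : ∏ i, B i i = (∏ i, c i) * ∏ i, c i := by
    rw [← Finset.prod_mul_distrib]
    exact Finset.prod_congr rfl fun i _ => (hcc i).symm
  rw [h3, det_mul, det_mul, det_diagonal, h4]
  have h5 : 0 < ∏ i, c i := Finset.prod_pos fun i _ => hc0 i
  nlinarith [mul_le_mul_of_nonneg_left h2 (mul_pos h5 h5).le]

open scoped ComplexOrder in
/-- The entrywise real part of a complex positive semidefinite matrix is positive semidefinite. -/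
theorem posSemidef_map_re {q : ℕ} {M : Matrix (Fin q) (Fin q) ℂ}
    (hM : M.PosSemidef) : (M.map Complex.re).PosSemidef := by
  refine PosSemidef.of_dotProduct_mulVec_nonneg ?_ fun x => ?_
  · ext r s
    have := congrArg Complex.re (congrFun (congrFun hM.1 r) s)
    simpa using this
  · have h := hM.dotProduct_mulVec_nonneg fun i => (x i : ℂ)
    have h2 := (Complex.le_def.1 h).1
    simpa [dotProduct, mulVec, Complex.re_sum] using h2

open scoped ComplexOrder MatrixOrder in
/-- Off-diagonal entries of a positive semidefinite matrix are dominated by the diagonal. -/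
theorem norm_apply_le_of_posSemidef {q : ℕ} {M : Matrix (Fin q) (Fin q) ℂ}
    (hM : M.PosSemidef) (r s : Fin q) :
    ‖M r s‖ ≤ ((M r r).re + (M s s).re) / 2 := by
  obtain ⟨B, rfl⟩ := CStarAlgebra.nonneg_iff_eq_star_mul_self.mp hM.nonneg
  have hdiag : ∀ r, ((star B * B) r r).re = ∑ k, ‖B k r‖ ^ 2 := fun r => by
    rw [star_eq_conjTranspose, mul_apply, Complex.re_sum]
    refine Finset.sum_congr rfl fun k _ => ?_
    rw [conjTranspose_apply, ← Complex.normSq_eq_norm_sq, Complex.normSq_apply]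
    simp
  rw [hdiag, hdiag, star_eq_conjTranspose, mul_apply, ← Finset.sum_add_distrib, Finset.sum_div]
  refine (norm_sum_le _ _).trans (Finset.sum_le_sum fun k _ => ?_)
  rw [conjTranspose_apply, norm_mul, norm_star]
  nlinarith [sq_nonneg (‖B k r‖ - ‖B k s‖)]

end determinants

/-! ### Weighted averages of triangular arrays -/

theorem sum_range_sum_Ioc {p : ℕ → ℕ} (hp : Monotone p) (f : ℕ → ℝ) (K : ℕ) :
    ∑ k ∈ Finset.range K, ∑ j ∈ Finset.Ioc (p k) (p (k + 1)), f j
      = ∑ j ∈ Finset.Ioc (p 0) (p K), f j := by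
  induction K with
  | zero => simp
  | succ K ih =>
    rw [Finset.sum_range_succ, ih,
      Finset.sum_Ioc_consecutive _ (hp (Nat.zero_le K)) (hp K.le_succ)]

/-- If the averages of a triangular array over all blocks `(xm, ym]` converge to `g (y - x)` and its
averaged absolute values stay bounded, then the array integrates continuous functions on `[κ, 1]`
in the limit: the step functions over a fine partition are covered by the assumption and
approximate uniformly. -/
theorem tendsto_average_mul_continuousOn {ι : Type*} {l : Filter ι} {m : ι → ℕ}
    {a : ι → ℕ → ℝ} {C g : ℝ}
    (hC : ∀ᶠ i in l, 1 / (m i : ℝ) * ∑ j ∈ Finset.Icc 1 (m i), |a i j| ≤ C)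
    (hblock : ∀ x y : ℝ, 0 ≤ x → x < y → y ≤ 1 → Tendsto (fun i => 1 / (m i : ℝ) *
      ∑ j ∈ Finset.Ioc ⌊x * m i⌋₊ ⌊y * m i⌋₊, a i j) l (𝓝 (g * (y - x))))
    (hm : Tendsto m l atTop) {κ : ℝ} (hκ0 : 0 ≤ κ) (hκ1 : κ < 1) {φ : ℝ → ℝ}
    (hφ : ContinuousOn φ (Set.Icc κ 1)) :
    Tendsto (fun i => 1 / (m i : ℝ) * ∑ j ∈ Finset.Ioc ⌊κ * m i⌋₊ (m i), φ (j / m i) * a i j) l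
      (𝓝 (g * ∫ x in κ..1, φ x)) := by
  rw [Metric.tendsto_nhds]
  intro ε hε
  set η := ε / (2 * (|C| + |g| + 1)) with hη
  have hη0 : 0 < η := by positivity
  have hηε : η * C + η * |g| + η ≤ ε / 2 := by
    have h1 : η * (|C| + |g| + 1) = ε / 2 := by
      rw [hη]; field_simp
    nlinarith [le_abs_self C]
  have huc := Metric.uniformContinuousOn_iff.1
    (isCompact_Icc.uniformContinuousOn_of_continuous hφ) η hη0
  obtain ⟨δ, hδ, huc⟩ := huc
  obtain ⟨L, hL⟩ := exists_nat_gt ((1 - κ) / δ)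
  have hL0 : (0 : ℝ) < L := lt_of_le_of_lt (div_nonneg (by linarith) hδ.le) hL
  set x : ℕ → ℝ := fun k => κ + (1 - κ) / L * k with hx
  have hstep : 0 < (1 - κ) / L := div_pos (by linarith) hL0
  have hstepδ : (1 - κ) / L < δ := by
    rw [div_lt_iff₀ hδ] at hL
    rw [div_lt_iff₀ hL0]; linarith
  have hx0 : x 0 = κ := by simp [hx]
  have hxL : x L = 1 := by
    simp only [hx]; field_simp; ring
  have hxs : ∀ k, x (k + 1) = x k + (1 - κ) / L := fun k => by
    simp only [hx]; push_cast; ring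
  have hxmono : Monotone x := monotone_nat_of_le_succ fun k => by rw [hxs]; linarith
  have hxI : ∀ k ≤ L, x k ∈ Set.Icc κ 1 := fun k hk =>
    ⟨hx0 ▸ hxmono (Nat.zero_le k), hxL ▸ hxmono hk⟩
  have hosc : ∀ k < L, ∀ y ∈ Set.Icc (x k) (x (k + 1)), |φ y - φ (x (k + 1))| ≤ η := by
    intro k hk y hy
    have := huc y ⟨(hxI k hk.le).1.trans hy.1, hy.2.trans (hxI (k + 1) hk).2⟩ (x (k + 1))
      (hxI (k + 1) hk) (by
        rw [Real.dist_eq, abs_lt]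
        constructor <;> linarith [hy.1, hy.2, hxs k])
    exact this.le
  -- the step function approximation and its limit
  have hT : Tendsto (fun i => ∑ k ∈ Finset.range L, φ (x (k + 1)) * (1 / (m i : ℝ) *
      ∑ j ∈ Finset.Ioc ⌊x k * m i⌋₊ ⌊x (k + 1) * m i⌋₊, a i j)) l
      (𝓝 (∑ k ∈ Finset.range L, φ (x (k + 1)) * (g * (x (k + 1) - x k)))) := by
    refine tendsto_finsetSum _ fun k hk => (hblock _ _ ?_ ?_ ?_).const_mul _
    · exact hκ0.trans (hxI k (Finset.mem_range.1 hk).le).1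
    · rw [hxs]; linarith
    · exact (hxI (k + 1) (Finset.mem_range.1 hk)).2
  have hint : |(∑ k ∈ Finset.range L, φ (x (k + 1)) * (g * (x (k + 1) - x k)))
      - g * ∫ x in κ..1, φ x| ≤ η * |g| := by
    have hii : ∀ k < L, IntervalIntegrable φ volume (x k) (x (k + 1)) := fun k hk => by
      refine ContinuousOn.intervalIntegrable_of_Icc (hxmono k.le_succ) (hφ.mono ?_)
      exact Set.Icc_subset_Icc (hxI k hk.le).1 (hxI (k + 1) hk).2
    have h1 := intervalIntegral.sum_integral_adjacent_intervals hii
    rw [hx0, hxL] at h1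
    rw [← h1, Finset.mul_sum, ← Finset.sum_sub_distrib]
    have h2 : ∀ k ∈ Finset.range L, |φ (x (k + 1)) * (g * (x (k + 1) - x k))
        - g * ∫ y in x k..x (k + 1), φ y| ≤ η * |g| * ((1 - κ) / L) := by
      intro k hk
      have hk := Finset.mem_range.1 hk
      have h3 : φ (x (k + 1)) * (g * (x (k + 1) - x k)) - g * ∫ y in x k..x (k + 1), φ y
          = -(g * ∫ y in x k..x (k + 1), (φ y - φ (x (k + 1)))) := by
        rw [intervalIntegral.integral_sub (hii k hk) intervalIntegrable_const,
          intervalIntegral.integral_const, smul_eq_mul]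
        ring
      have h4 : ‖∫ y in x k..x (k + 1), (φ y - φ (x (k + 1)))‖ ≤ η * |x (k + 1) - x k| := by
        refine intervalIntegral.norm_integral_le_of_norm_le_const fun y hy => ?_
        rw [Set.uIoc_of_le (hxmono k.le_succ)] at hy
        exact hosc k hk y ⟨hy.1.le, hy.2⟩
      rw [hxs k, add_sub_cancel_left, abs_of_pos hstep, ← hxs k, Real.norm_eq_abs] at h4
      rw [h3, abs_neg, abs_mul]
      calc _ ≤ |g| * (η * ((1 - κ) / L)) := mul_le_mul_of_nonneg_left h4 (abs_nonneg _)
        _ = _ := by ring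
    calc _ ≤ _ := Finset.abs_sum_le_sum_abs _ _
      _ ≤ ∑ k ∈ Finset.range L, η * |g| * ((1 - κ) / L) := Finset.sum_le_sum h2
      _ = η * |g| * (1 - κ) := by
        rw [Finset.sum_const, Finset.card_range, nsmul_eq_mul]; field_simp
      _ ≤ η * |g| := mul_le_of_le_one_right (by positivity) (by linarith)
  filter_upwards [hC, hm.eventually_ge_atTop 1, Metric.tendsto_nhds.1 hT η hη0] with i hCi hmi hTi
  have hmi0 : (0 : ℝ) < m i := by exact_mod_cast hmi
  set p : ℕ → ℕ := fun k => ⌊x k * m i⌋₊ with hp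
  have hpmono : Monotone p := fun k k' h =>
    Nat.floor_le_floor (mul_le_mul_of_nonneg_right (hxmono h) hmi0.le)
  have hpL : p L = m i := by simp [hp, hxL]
  have hS : |1 / (m i : ℝ) * ∑ j ∈ Finset.Ioc ⌊κ * m i⌋₊ (m i), φ (j / m i) * a i j
      - ∑ k ∈ Finset.range L, φ (x (k + 1)) * (1 / (m i : ℝ) *
      ∑ j ∈ Finset.Ioc (p k) (p (k + 1)), a i j)| ≤ η * C := by
    have h0 : ⌊κ * m i⌋₊ = p 0 := by rw [hp]; simp only [hx0]
    rw [h0, ← hpL, ← sum_range_sum_Ioc hpmono, hpL, Finset.mul_sum, ← Finset.sum_sub_distrib]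
    have h1 : ∀ k ∈ Finset.range L, |1 / (m i : ℝ) * ∑ j ∈ Finset.Ioc (p k) (p (k + 1)),
        φ (j / m i) * a i j - φ (x (k + 1)) * (1 / (m i : ℝ) *
        ∑ j ∈ Finset.Ioc (p k) (p (k + 1)), a i j)|
        ≤ η * (1 / (m i : ℝ)) * ∑ j ∈ Finset.Ioc (p k) (p (k + 1)), |a i j| := by
      intro k hk
      have hk := Finset.mem_range.1 hk
      have h2 : 1 / (m i : ℝ) * ∑ j ∈ Finset.Ioc (p k) (p (k + 1)),
          φ (j / m i) * a i j - φ (x (k + 1)) * (1 / (m i : ℝ) *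
          ∑ j ∈ Finset.Ioc (p k) (p (k + 1)), a i j) = (1 / (m i : ℝ)) *
          ∑ j ∈ Finset.Ioc (p k) (p (k + 1)), (φ (j / m i) - φ (x (k + 1))) * a i j := by
        simp only [sub_mul, Finset.sum_sub_distrib, ← Finset.mul_sum]
        ring
      rw [h2, abs_mul, abs_of_pos (by positivity), mul_comm η, mul_assoc]
      refine mul_le_mul_of_nonneg_left ?_ (by positivity)
      rw [Finset.mul_sum]
      refine (Finset.abs_sum_le_sum_abs _ _).trans (Finset.sum_le_sum fun j hj => ?_)
      rw [Finset.mem_Ioc] at hj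
      rw [abs_mul]
      refine mul_le_mul_of_nonneg_right (hosc k hk _ ⟨?_, ?_⟩) (abs_nonneg _)
      · rw [le_div_iff₀ hmi0]
        exact (Nat.lt_of_floor_lt hj.1).le
      · rw [div_le_iff₀ hmi0]
        refine (Nat.le_floor_iff ?_).1 hj.2
        exact mul_nonneg (hκ0.trans (hxI (k + 1) hk).1) hmi0.le
    calc _ ≤ _ := Finset.abs_sum_le_sum_abs _ _
      _ ≤ _ := Finset.sum_le_sum h1
      _ = η * (1 / (m i : ℝ) * ∑ j ∈ Finset.Ioc (p 0) (m i), |a i j|) := by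
        rw [← Finset.mul_sum, sum_range_sum_Ioc hpmono, hpL, mul_assoc]
      _ ≤ η * (1 / (m i : ℝ) * ∑ j ∈ Finset.Icc 1 (m i), |a i j|) := by
        refine mul_le_mul_of_nonneg_left (mul_le_mul_of_nonneg_left ?_ (by positivity)) hη0.le
        refine Finset.sum_le_sum_of_subset_of_nonneg (fun j hj => ?_) fun _ _ _ => abs_nonneg _
        rw [Finset.mem_Ioc] at hj
        rw [Finset.mem_Icc]; omega
      _ ≤ η * C := mul_le_mul_of_nonneg_left hCi hη0.le
  rw [Real.dist_eq] at hTi ⊢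
  have := abs_sub_le (1 / (m i : ℝ) * ∑ j ∈ Finset.Ioc ⌊κ * m i⌋₊ (m i), φ (j / m i) * a i j)
    (∑ k ∈ Finset.range L, φ (x (k + 1)) * (1 / (m i : ℝ) *
      ∑ j ∈ Finset.Ioc (p k) (p (k + 1)), a i j)) (g * ∫ x in κ..1, φ x)
  have h2 := abs_sub_le (∑ k ∈ Finset.range L, φ (x (k + 1)) * (1 / (m i : ℝ) *
      ∑ j ∈ Finset.Ioc (p k) (p (k + 1)), a i j))
    (∑ k ∈ Finset.range L, φ (x (k + 1)) * (g * (x (k + 1) - x k))) (g * ∫ x in κ..1, φ x)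
  linarith

/-- Version of `tendsto_average_mul_continuousOn` for uniformly convergent integrands. -/
theorem tendsto_average_mul_tendstoUniformlyOn {ι : Type*} {l : Filter ι} {m : ι → ℕ}
    {a : ι → ℕ → ℝ} {C g : ℝ}
    (hC : ∀ᶠ i in l, 1 / (m i : ℝ) * ∑ j ∈ Finset.Icc 1 (m i), |a i j| ≤ C)
    (hblock : ∀ x y : ℝ, 0 ≤ x → x < y → y ≤ 1 → Tendsto (fun i => 1 / (m i : ℝ) *
      ∑ j ∈ Finset.Ioc ⌊x * m i⌋₊ ⌊y * m i⌋₊, a i j) l (𝓝 (g * (y - x))))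
    (hm : Tendsto m l atTop) {κ : ℝ} (hκ0 : 0 ≤ κ) (hκ1 : κ < 1) {φ : ℝ → ℝ} {ψ : ι → ℝ → ℝ}
    (hφ : ContinuousOn φ (Set.Icc κ 1)) (hψ : TendstoUniformlyOn ψ φ l (Set.Icc κ 1)) :
    Tendsto (fun i => 1 / (m i : ℝ) * ∑ j ∈ Finset.Ioc ⌊κ * m i⌋₊ (m i), ψ i (j / m i) * a i j) l
      (𝓝 (g * ∫ x in κ..1, φ x)) := by
  have h := tendsto_average_mul_continuousOn hC hblock hm hκ0 hκ1 hφ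
  have hd : Tendsto (fun i => 1 / (m i : ℝ) * ∑ j ∈ Finset.Ioc ⌊κ * m i⌋₊ (m i),
      (ψ i (j / m i) - φ (j / m i)) * a i j) l (𝓝 0) := by
    rw [Metric.tendsto_nhds]
    intro ε hε
    have hη0 : 0 < ε / (|C| + 1) := by positivity
    filter_upwards [hC, hm.eventually_ge_atTop 1, Metric.tendstoUniformlyOn_iff.1 hψ _ hη0]
      with i hCi hmi hi
    have hmi0 : (0 : ℝ) < m i := by exact_mod_cast hmi
    rw [dist_zero_right, norm_mul, Real.norm_of_nonneg (by positivity)]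
    calc _ ≤ 1 / (m i : ℝ) * ∑ j ∈ Finset.Ioc ⌊κ * m i⌋₊ (m i), ε / (|C| + 1) * |a i j| := by
          refine mul_le_mul_of_nonneg_left ?_ (by positivity)
          refine (norm_sum_le _ _).trans (Finset.sum_le_sum fun j hj => ?_)
          rw [Finset.mem_Ioc] at hj
          rw [norm_mul, Real.norm_eq_abs (a i j)]
          refine mul_le_mul_of_nonneg_right ?_ (abs_nonneg _)
          have := hi (j / m i) ⟨?_, ?_⟩
          · rw [dist_comm, dist_eq_norm] at this
            exact this.le
          · rw [le_div_iff₀ hmi0]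
            exact (Nat.lt_of_floor_lt hj.1).le
          · rw [div_le_one hmi0]
            exact_mod_cast hj.2
      _ ≤ 1 / (m i : ℝ) * ∑ j ∈ Finset.Icc 1 (m i), ε / (|C| + 1) * |a i j| := by
          refine mul_le_mul_of_nonneg_left ?_ (by positivity)
          refine Finset.sum_le_sum_of_subset_of_nonneg (fun j hj => ?_) fun _ _ _ => by positivity
          rw [Finset.mem_Ioc] at hj
          rw [Finset.mem_Icc]; omega
      _ = ε / (|C| + 1) * (1 / (m i : ℝ) * ∑ j ∈ Finset.Icc 1 (m i), |a i j|) := by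
          rw [← Finset.mul_sum]; ring
      _ ≤ ε / (|C| + 1) * C := mul_le_mul_of_nonneg_left hCi hη0.le
      _ < ε := by
          rw [div_mul_eq_mul_div, div_lt_iff₀ (by positivity)]
          nlinarith [le_abs_self C]
  have h3 := h.add hd
  rw [add_zero] at h3
  refine h3.congr fun i => ?_
  rw [← mul_add, ← Finset.sum_add_distrib]
  congr 1
  exact Finset.sum_congr rfl fun j _ => by ring

/-- On `[κ, 1]` with `κ > 0`, the powers `x ^ p` depend uniformly continuously on `p`. -/
theorem tendstoUniformlyOn_rpow {ι : Type*} {l : Filter ι} {p : ι → ℝ} {p₀ κ : ℝ} (hκ : 0 < κ)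
    (hp : Tendsto p l (𝓝 p₀)) :
    TendstoUniformlyOn (fun i x => x ^ p i) (fun x : ℝ => x ^ p₀) l (Set.Icc κ 1) := by
  rw [Metric.tendstoUniformlyOn_iff]
  intro ε hε
  have hcont : ContinuousOn (Function.uncurry fun (q x : ℝ) => x ^ q)
      (Set.univ ×ˢ Set.Icc κ 1) := by
    intro z hz
    have hz2 : 0 < z.2 := hκ.trans_le hz.2.1
    exact (Real.continuousAt_rpow (z.2, z.1) (Or.inl hz2.ne')).comp_continuousWithinAt
      (f := fun w : ℝ × ℝ => (w.2, w.1)) (by fun_prop)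
  obtain ⟨v, hv, h⟩ := isCompact_Icc.mem_uniformity_of_prod hcont (Set.mem_univ p₀)
    (Metric.dist_mem_uniformity hε)
  rw [nhdsWithin_univ] at hv
  filter_upwards [hp hv] with i hi x hx
  rw [dist_comm]
  exact h _ hi x hx

/-! ### Convergence in probability as convergence along a filter -/

/-- The filter on `ℕ × Ω` of sets that hold with probability tending to one. Convergence in
probability to a constant is convergence along this filter; outer measure is used, so that no
measurability is needed. -/
def probFilter {Ω : Type*} [MeasurableSpace Ω] (μ : Measure Ω) : Filter (ℕ × Ω) where
  sets := {S | Tendsto (fun n : ℕ => μ {ω | (n, ω) ∉ S}) atTop (𝓝 0)}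
  univ_sets := by simp
  sets_of_superset {S T} hS hST := by
    refine tendsto_of_tendsto_of_tendsto_of_le_of_le tendsto_const_nhds hS
      (fun _ => zero_le) fun n => measure_mono fun ω hω h => hω (hST h)
  inter_sets {S T} hS hT := by
    have h := Tendsto.add hS hT
    rw [add_zero] at h
    refine tendsto_of_tendsto_of_tendsto_of_le_of_le tendsto_const_nhds h
      (fun _ => zero_le) fun n => ?_
    refine (measure_mono ?_).trans (measure_union_le _ _)
    intro ω hω
    by_contra hcon
    simp only [Set.mem_union, Set.mem_ofPred_eq, not_or, not_not] at hcon
    exact hω ⟨hcon.1, hcon.2⟩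

theorem eventually_probFilter {Ω : Type*} [MeasurableSpace Ω] {μ : Measure Ω}
    {p : ℕ × Ω → Prop} : (∀ᶠ z in probFilter μ, p z) ↔
      Tendsto (fun n : ℕ => μ {ω | ¬ p (n, ω)}) atTop (𝓝 0) := Iff.rfl

theorem tendsto_fst_probFilter {Ω : Type*} [MeasurableSpace Ω] (μ : Measure Ω) :
    Tendsto (Prod.fst : ℕ × Ω → ℕ) (probFilter μ) atTop := by
  rw [tendsto_atTop]
  intro N
  rw [eventually_probFilter]
  refine tendsto_const_nhds.congr' ?_
  filter_upwards [eventually_ge_atTop N] with n hn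
  simp [hn]

theorem eventually_probFilter_of_ae {Ω : Type*} [MeasurableSpace Ω] {μ : Measure Ω}
    {p : ℕ × Ω → Prop} (h : ∀ᶠ n in atTop, ∀ᵐ ω ∂μ, p (n, ω)) : ∀ᶠ z in probFilter μ, p z := by
  rw [eventually_probFilter]
  refine tendsto_const_nhds.congr' ?_
  filter_upwards [h] with n hn
  exact (ae_iff.1 hn).symm

theorem tendstoInMeasure_const_iff {Ω : Type*} [MeasurableSpace Ω] {μ : Measure Ω} {E : Type*}
    [PseudoEMetricSpace E] {f : ℕ → Ω → E} {c : E} :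
    TendstoInMeasure μ f atTop (fun _ => c) ↔
      Tendsto (fun z : ℕ × Ω => f z.1 z.2) (probFilter μ) (𝓝 c) := by
  rw [EMetric.tendsto_nhds]
  simp only [eventually_probFilter, not_lt, TendstoInMeasure, gt_iff_lt]

/-! ### Averages of logarithms and moments of powers -/

theorem sum_log_eq_log_factorial (m : ℕ) :
    ∑ j ∈ Finset.Icc 1 m, Real.log j = Real.log m.factorial := by
  induction m with
  | zero => simp
  | succ m ih =>
    rw [Finset.sum_Icc_succ_top (by omega), ih, Nat.factorial_succ, Nat.cast_mul,
      Real.log_mul (by positivity) (by positivity), add_comm]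

/-- The averages of `log (j / m)` over `1 ≤ j ≤ m` converge to `∫₀¹ log x = -1`. -/
theorem tendsto_average_log_div : Tendsto (fun m : ℕ => 1 / (m : ℝ) *
    ∑ j ∈ Finset.Icc 1 m, Real.log (j / m)) atTop (𝓝 (-1)) := by
  have h1 : Tendsto (fun m : ℕ => Real.log (Stirling.stirlingSeq m) / m
      + (1 / 2) * (Real.log (2 * m) / (m : ℝ)) - 1) atTop (𝓝 (0 + (1 / 2) * 0 - 1)) := by
    refine ((Tendsto.div_atTop (a := Real.log √Real.pi) ?_ tendsto_natCast_atTop_atTop).add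
      (Tendsto.const_mul _ ?_)).sub_const 1
    · exact ((Real.continuousAt_log (by positivity)).tendsto).comp
        Stirling.tendsto_stirlingSeq_sqrt_pi
    · have h2 : Tendsto (fun x : ℝ => Real.log x / x) atTop (𝓝 0) := by
        simpa using Real.tendsto_pow_log_div_mul_add_atTop 1 0 1 one_ne_zero
      have h3 : Tendsto (fun m : ℕ => 2 * (m : ℝ)) atTop atTop :=
        tendsto_natCast_atTop_atTop.const_mul_atTop two_pos
      have h4 := (h2.comp h3).const_mul 2
      rw [mul_zero] at h4
      refine h4.congr fun m => ?_
      simp only [Function.comp]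
      rw [mul_div_assoc', mul_div_mul_left _ _ two_ne_zero]
  norm_num at h1
  refine h1.congr' ?_
  filter_upwards [eventually_ge_atTop 1] with m hm
  have hm0 : (0 : ℝ) < m := by exact_mod_cast hm
  have h5 : ∑ j ∈ Finset.Icc 1 m, Real.log (j / m)
      = Real.log (m.factorial) - m * Real.log m := by
    have h6 : ∀ j ∈ Finset.Icc 1 m, Real.log (j / m) = Real.log j - Real.log m := fun j hj => by
      have : (j : ℝ) ≠ 0 := by
        have := (Finset.mem_Icc.1 hj).1
        positivity
      exact Real.log_div this hm0.ne'
    rw [Finset.sum_congr rfl h6, Finset.sum_sub_distrib, sum_log_eq_log_factorial]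
    simp
  rw [h5, Stirling.log_stirlingSeq_formula, Real.log_div hm0.ne' (Real.exp_pos 1).ne',
    Real.log_exp]
  field_simp
  ring

/-- `∫_κ^1 x^{2θ} dx · e^{2θ}` is in the limit `κ → 0` bounded below by a number `≥ 1` which is
`1` only for `θ = 0`. For `2θ > -9/10` this is `e^{2θ} / (1 + 2θ)`; otherwise the exponent is
first raised to `-9/10`, where the limit `10 e^{2θ} ≥ 10 e^{-2}` already exceeds one. -/
theorem exists_lower_limit_integral_rpow {θ : ℝ} (hθ : -1 ≤ θ) : ∃ (w : ℝ) (h : ℝ → ℝ),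
    1 ≤ w ∧ (w = 1 → θ = 0) ∧ Tendsto h (𝓝[>] 0) (𝓝 w) ∧ (∀ κ ∈ Set.Ioo (0 : ℝ) 1, 0 ≤ h κ) ∧
    ∀ κ ∈ Set.Ioo (0 : ℝ) 1, h κ ≤ (∫ x in κ..1, x ^ (θ + θ)) * Real.exp (2 * θ) := by
  set p : ℝ := max (2 * θ) (-9 / 10) with hp
  have hp1 : 0 < p + 1 := by
    have := le_max_right (2 * θ) (-9 / 10)
    linarith
  have hexp : Real.exp 2 < 10 := by
    have h1 := Real.exp_one_lt_d9
    have h2 : Real.exp 2 = Real.exp 1 * Real.exp 1 := by rw [← Real.exp_add]; norm_num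
    have h3 := Real.exp_pos 1
    rw [h2]; nlinarith
  have hw : 1 ≤ Real.exp (2 * θ) / (p + 1) ∧ (Real.exp (2 * θ) / (p + 1) = 1 → θ = 0) := by
    rw [le_div_iff₀ hp1, div_eq_one_iff_eq hp1.ne']
    rcases le_total (-9 / 10) (2 * θ) with h | h
    · rw [hp, max_eq_left h]
      refine ⟨by linarith [Real.add_one_le_exp (2 * θ)], fun h2 => ?_⟩
      by_contra h3
      have := Real.add_one_lt_exp (x := 2 * θ) (by simpa using h3)
      linarith
    · rw [hp, max_eq_right h]
      have h1 : (1 : ℝ) / 10 < Real.exp (2 * θ) := by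
        calc (1 : ℝ) / 10 < 1 / Real.exp 2 := one_div_lt_one_div_of_lt (Real.exp_pos _) hexp
          _ = Real.exp (-2) := by rw [Real.exp_neg, one_div]
          _ ≤ _ := Real.exp_le_exp.2 (by linarith)
      exact ⟨by linarith, fun h2 => by linarith⟩
  refine ⟨Real.exp (2 * θ) / (p + 1), fun κ => (1 - κ ^ (p + 1)) / (p + 1) * Real.exp (2 * θ),
    hw.1, hw.2, ?_, ?_, ?_⟩
  · have h1 : Tendsto (fun κ : ℝ => κ ^ (p + 1)) (𝓝[>] 0) (𝓝 0) := by
      have := (Real.continuousAt_rpow_const 0 (p + 1) (Or.inr hp1.le)).tendsto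
      rw [Real.zero_rpow hp1.ne'] at this
      exact this.mono_left nhdsWithin_le_nhds
    have h2 := (((tendsto_const_nhds (x := (1 : ℝ))).sub h1).div_const (p + 1)).mul_const
      (Real.exp (2 * θ))
    convert h2 using 2
    ring
  · intro κ hκ
    have : κ ^ (p + 1) ≤ 1 := Real.rpow_le_one hκ.1.le hκ.2.le hp1.le
    have : 0 ≤ 1 - κ ^ (p + 1) := by linarith
    positivity
  · intro κ hκ
    refine mul_le_mul_of_nonneg_right ?_ (Real.exp_pos _).le
    have hnot : (0 : ℝ) ∉ Set.uIcc κ 1 := by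
      rw [Set.uIcc_of_le hκ.2.le]
      exact fun h => absurd h.1 (not_le.2 hκ.1)
    have h1 : ∫ x in κ..1, x ^ p = (1 - κ ^ (p + 1)) / (p + 1) := by
      rw [integral_rpow (Or.inl (by linarith)), Real.one_rpow]
    rw [← h1]
    refine intervalIntegral.integral_mono_on hκ.2.le
      (intervalIntegral.intervalIntegrable_rpow (Or.inr hnot))
      (intervalIntegral.intervalIntegrable_rpow (Or.inr hnot)) fun x hx => ?_
    refine Real.rpow_le_rpow_of_exponent_ge (hκ.1.trans_le hx.1) hx.2 ?_
    rw [← two_mul]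
    exact le_max_left _ _

/-- The limiting form of the minimisation inequality identifies the true parameter. -/
theorem eq_zero_of_prod_integral_rpow_le_one {q : ℕ} {θ : Fin q → ℝ} (hθ : ∀ r, -1 ≤ θ r)
    (h : ∀ κ ∈ Set.Ioo (0 : ℝ) 1,
      ∏ r, ((∫ x in κ..1, x ^ (θ r + θ r)) * Real.exp (2 * θ r)) ≤ 1) : θ = 0 := by
  choose w g hw1 hw0 hg hg0 hgle using fun r => exists_lower_limit_integral_rpow (hθ r)
  have hev : ∀ᶠ κ : ℝ in 𝓝[>] 0, κ ∈ Set.Ioo (0 : ℝ) 1 :=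
    Ioo_mem_nhdsGT one_pos
  have hlim : ∏ r, w r ≤ 1 := by
    refine le_of_tendsto (tendsto_finsetProd _ fun r _ => hg r) ?_
    filter_upwards [hev] with κ hκ
    exact (Finset.prod_le_prod (fun r _ => hg0 r κ hκ) fun r _ => hgle r κ hκ).trans (h κ hκ)
  funext r
  refine hw0 r (le_antisymm ?_ (hw1 r))
  refine le_trans ?_ hlim
  rw [← Finset.mul_prod_erase _ _ (Finset.mem_univ r)]
  refine le_mul_of_one_le_right (zero_le_one.trans (hw1 r)) ?_
  calc (1 : ℝ) = ∏ _i ∈ Finset.univ.erase r, 1 := by simp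
    _ ≤ _ := Finset.prod_le_prod (fun _ _ => zero_le_one) fun i _ => hw1 i

open Matrix

section moments

variable {q : ℕ}

/-- The matrix of moments `∫_κ^1 x^{θ_r + θ_s} dx`. -/
noncomputable def momentMatrix (κ : ℝ) (θ : Fin q → ℝ) :
    Matrix (Fin q) (Fin q) ℝ :=
  of fun r s => ∫ x in κ..1, x ^ (θ r + θ s)

theorem intervalIntegrable_rpow_of_mem_Ioo {κ : ℝ} (hκ : κ ∈ Set.Ioo (0 : ℝ) 1)
    (p : ℝ) : IntervalIntegrable (fun x : ℝ => x ^ p) volume κ 1 := by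
  refine intervalIntegral.intervalIntegrable_rpow (Or.inr ?_)
  rw [Set.uIcc_of_le hκ.2.le]
  exact fun h => absurd h.1 (not_le.2 hκ.1)

theorem momentMatrix_posSemidef {κ : ℝ} (hκ : κ ∈ Set.Ioo (0 : ℝ) 1)
    (θ : Fin q → ℝ) : (momentMatrix κ θ).PosSemidef := by
  refine PosSemidef.of_dotProduct_mulVec_nonneg ?_ fun v => ?_
  · ext r s
    simp [momentMatrix, add_comm]
  · have h : star v ⬝ᵥ momentMatrix κ θ *ᵥ v
        = ∫ x in κ..1, ∑ r, ∑ s, v r * (x ^ (θ r + θ s) * v s) := by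
      rw [intervalIntegral.integral_finsetSum]
      · simp only [dotProduct, mulVec, momentMatrix, of_apply, Pi.star_apply, star_trivial]
        refine Finset.sum_congr rfl fun r _ => ?_
        rw [intervalIntegral.integral_finsetSum]
        · rw [Finset.mul_sum]
          refine Finset.sum_congr rfl fun s _ => ?_
          rw [intervalIntegral.integral_const_mul, intervalIntegral.integral_mul_const]
        · exact fun s _ => ((intervalIntegrable_rpow_of_mem_Ioo hκ _).mul_const _).const_mul _
      · intro r _
        have := IntervalIntegrable.sum (μ := volume) (a := κ) (b := 1) Finset.univ
          (f := fun s x => v r * (x ^ (θ r + θ s) * v s))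
          fun s _ => ((intervalIntegrable_rpow_of_mem_Ioo hκ _).mul_const _).const_mul _
        simpa only [Finset.sum_fn] using this
    rw [h]
    refine intervalIntegral.integral_nonneg hκ.2.le fun x hx => ?_
    have hx0 : 0 < x := hκ.1.trans_le hx.1
    have h2 : ∑ r, ∑ s, v r * (x ^ (θ r + θ s) * v s) = (∑ r, v r * x ^ θ r) ^ 2 := by
      rw [sq, Finset.sum_mul_sum]
      refine Finset.sum_congr rfl fun r _ => Finset.sum_congr rfl fun s _ => ?_
      rw [Real.rpow_add hx0]
      ring
    rw [h2]
    positivity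

theorem momentMatrix_diag_pos {κ : ℝ} (hκ : κ ∈ Set.Ioo (0 : ℝ) 1)
    (θ : Fin q → ℝ) (r : Fin q) : 0 < momentMatrix κ θ r r := by
  refine intervalIntegral.intervalIntegral_pos_of_pos_on
    (intervalIntegrable_rpow_of_mem_Ioo hκ _) (fun x hx => ?_) hκ.2
  exact Real.rpow_pos_of_pos (hκ.1.trans hx.1) _

end moments

/-! ### Algebra of the objective function -/

/-- The summand of `Ĝ(d₀)` at the frequency `λ_j`: the real part of `diag(λ_j^{d₀}) M diag(λ_j^{d₀})`,
where `M` stands for the value of the spectral estimator at `λ_j`. -/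
noncomputable def rescaledRe {q : ℕ} (d₀ : Fin q → ℝ) (n j : ℕ) (M : Matrix (Fin q) (Fin q) ℂ) :
    Matrix (Fin q) (Fin q) ℝ :=
  (diagonal (fun i => ((fourierFreq n j ^ d₀ i : ℝ) : ℂ)) * M
    * diagonal (fun i => ((fourierFreq n j ^ d₀ i : ℝ) : ℂ))).map Complex.re

/-- The limit of `Ĝ(d₀)`: the real part of `e^{iπ(d_r-d_s)/2} G_{rs}`. -/
noncomputable def limitMatrix {q : ℕ} (d₀ : Fin q → ℝ) (G₀ : Matrix (Fin q) (Fin q) ℝ) :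
    Matrix (Fin q) (Fin q) ℝ :=
  of fun r s => Real.cos (Real.pi * (d₀ r - d₀ s) / 2) * G₀ r s

theorem fourierFreq_pos {n j : ℕ} (hn : 1 ≤ n) (hj : 1 ≤ j) : 0 < fourierFreq n j := by
  have h1 : (0 : ℝ) < n := by exact_mod_cast hn
  have h2 : (0 : ℝ) < j := by exact_mod_cast hj
  unfold fourierFreq
  positivity

theorem fourierFreq_mono {n j k : ℕ} (h : j ≤ k) : fourierFreq n j ≤ fourierFreq n k := by
  unfold fourierFreq
  have : (j : ℝ) ≤ k := by exact_mod_cast h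
  gcongr

theorem fourierFreq_eq_mul_div {n m j : ℕ} (hm : 1 ≤ m) :
    fourierFreq n j = fourierFreq n m * (j / m) := by
  have h1 : (m : ℝ) ≠ 0 := by positivity
  unfold fourierFreq
  field_simp

theorem limitMatrix_posDef {q : ℕ} {d₀ : Fin q → ℝ} {G₀ : Matrix (Fin q) (Fin q) ℝ}
    (hG₀ : G₀.PosDef) (hd₀ : ∀ k, d₀ k ∈ Set.Ioo (-(1 / 2) : ℝ) (1 / 2)) :
    (limitMatrix d₀ G₀).PosDef := by
  set c : Fin q → ℝ := fun r => Real.cos (Real.pi * d₀ r / 2)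
  set s : Fin q → ℝ := fun r => Real.sin (Real.pi * d₀ r / 2)
  have hc : ∀ r, c r ≠ 0 := fun r => by
    have h := hd₀ r
    have hpi := Real.pi_pos
    exact (Real.cos_pos_of_mem_Ioo ⟨by nlinarith [h.1], by nlinarith [h.2]⟩).ne'
  -- the addition formula for the cosine splits the matrix into two congruences of `G₀`
  have h : limitMatrix d₀ G₀ = (diagonal c)ᴴ * G₀ * diagonal c + (diagonal s)ᴴ * G₀ * diagonal s := by
    ext i j
    simp only [limitMatrix, of_apply, Matrix.add_apply, diagonal_conjTranspose, mul_diagonal,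
      diagonal_mul, c, s, star_trivial]
    rw [mul_sub, sub_div, Real.cos_sub]
    ring
  rw [h]
  refine PosDef.add_posSemidef (hG₀.conjTranspose_mul_mul_same ?_)
    (hG₀.posSemidef.conjTranspose_mul_mul_same _)
  refine mulVec_injective_of_isUnit ?_
  rw [isUnit_iff_isUnit_det, det_diagonal, isUnit_iff_ne_zero]
  exact Finset.prod_ne_zero_iff.2 fun i _ => hc i

theorem conjTranspose_diagonal_ofReal {q : ℕ} (x : Fin q → ℝ) :
    (diagonal fun i => (x i : ℂ))ᴴ = diagonal fun i => (x i : ℂ) := by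
  rw [diagonal_conjTranspose]
  congr 1
  funext i
  exact Complex.conj_ofReal _

section pointwise

variable {q : ℕ} {d₀ : Fin q → ℝ} {n j : ℕ} {M : Matrix (Fin q) (Fin q) ℂ}

theorem rescaledRe_apply (hn : 1 ≤ n) (hj : 1 ≤ j) (r s : Fin q) :
    rescaledRe d₀ n j M r s = (Complex.exp (Complex.I *
      (-((fourierFreq n j - Real.pi) * (d₀ r - d₀ s) / 2) : ℝ))
        * normalizedEntry d₀ n j M r s).re := by
  rw [rescaledRe, map_apply, mul_diagonal, diagonal_mul, normalizedEntry,
    Real.rpow_add (fourierFreq_pos hn hj), ← mul_assoc, ← mul_assoc, ← Complex.exp_add]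
  push_cast
  rw [show ∀ z : ℂ, Complex.I * (-z) + Complex.I * z = 0 from fun z => by ring, Complex.exp_zero]
  congr 1
  ring

theorem norm_exp_I_mul (x : ℝ) : ‖Complex.exp (Complex.I * (x : ℂ))‖ = 1 := by
  rw [mul_comm]; exact Complex.norm_exp_ofReal_mul_I x

theorem abs_rescaledRe_le (hn : 1 ≤ n) (hj : 1 ≤ j) (r s : Fin q) :
    |rescaledRe d₀ n j M r s| ≤ ‖normalizedEntry d₀ n j M r s‖ := by
  rw [rescaledRe_apply hn hj]
  refine (Complex.abs_re_le_norm _).trans ?_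
  rw [norm_mul, norm_exp_I_mul, one_mul]

/-- Replacing the phase `e^{-i(λ_j - π)c}` by its value at frequency zero costs at most `λ_j |c|`. -/
theorem abs_rescaledRe_sub_le (hn : 1 ≤ n) (hj : 1 ≤ j) (r s : Fin q) :
    |rescaledRe d₀ n j M r s - (Complex.exp (Complex.I * (Real.pi * (d₀ r - d₀ s) / 2 : ℝ))
        * normalizedEntry d₀ n j M r s).re|
      ≤ fourierFreq n j * |(d₀ r - d₀ s) / 2| * ‖normalizedEntry d₀ n j M r s‖ := by
  rw [rescaledRe_apply hn hj, ← Complex.sub_re, ← sub_mul]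
  refine (Complex.abs_re_le_norm _).trans ?_
  rw [norm_mul]
  refine mul_le_mul_of_nonneg_right ?_ (norm_nonneg _)
  have h : Complex.exp (Complex.I * (-((fourierFreq n j - Real.pi) * (d₀ r - d₀ s) / 2) : ℝ))
      - Complex.exp (Complex.I * (Real.pi * (d₀ r - d₀ s) / 2 : ℝ))
      = Complex.exp (Complex.I * (Real.pi * (d₀ r - d₀ s) / 2 : ℝ))
        * (Complex.exp (Complex.I * (-(fourierFreq n j * ((d₀ r - d₀ s) / 2)) : ℝ)) - 1) := by
    rw [mul_sub (Complex.exp _), ← Complex.exp_add, mul_one]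
    congr 2
    push_cast
    ring
  rw [h, norm_mul, norm_exp_I_mul, one_mul]
  refine (Real.norm_exp_I_mul_ofReal_sub_one_le).trans ?_
  rw [norm_neg, norm_mul, Real.norm_of_nonneg (fourierFreq_pos hn hj).le, Real.norm_eq_abs]

open scoped ComplexOrder in
theorem rescaledRe_posSemidef (hM : M.PosSemidef) : (rescaledRe d₀ n j M).PosSemidef := by
  refine posSemidef_map_re ?_
  have := hM.conjTranspose_mul_mul_same (diagonal fun i => ((fourierFreq n j ^ d₀ i : ℝ) : ℂ))
  rwa [conjTranspose_diagonal_ofReal] at this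

open scoped ComplexOrder in
theorem norm_normalizedEntry_le (hM : M.PosSemidef) (hn : 1 ≤ n) (hj : 1 ≤ j) (r s : Fin q) :
    ‖normalizedEntry d₀ n j M r s‖
      ≤ ((normalizedEntry d₀ n j M r r).re + (normalizedEntry d₀ n j M s s).re) / 2 := by
  set D : Matrix (Fin q) (Fin q) ℂ := diagonal fun i => ((fourierFreq n j ^ d₀ i : ℝ) : ℂ)
    with hD
  have h1 : (D * M * D).PosSemidef := by
    have := hM.conjTranspose_mul_mul_same D
    rwa [hD, conjTranspose_diagonal_ofReal] at this
  have h2 : ∀ r s, normalizedEntry d₀ n j M r s = Complex.exp (Complex.I *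
      ((fourierFreq n j - Real.pi) * (d₀ r - d₀ s) / 2 : ℝ)) * (D * M * D) r s := fun r s => by
    rw [normalizedEntry, hD, mul_diagonal, diagonal_mul, Real.rpow_add (fourierFreq_pos hn hj)]
    push_cast
    ring
  have h3 : ∀ r, normalizedEntry d₀ n j M r r = (D * M * D) r r := fun r => by
    rw [h2]; simp
  rw [h2 r s, h3, h3, norm_mul, norm_exp_I_mul, one_mul]
  exact norm_apply_le_of_posSemidef h1 r s

end pointwise

/-- `(1/m) ∑_{a < j ≤ m} diag((j/m)^θ) W_j diag((j/m)^θ)`, where `W_j` is the summand of `Ĝ(d₀)`.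
For `a = 0` this is `Ĝ(d₀ + θ)` with the powers of `λ_m` taken out. -/
noncomputable def tailMatrix {q : ℕ} (d₀ : Fin q → ℝ) (n m a : ℕ)
    (F : ℝ → Matrix (Fin q) (Fin q) ℂ) (θ : Fin q → ℝ) : Matrix (Fin q) (Fin q) ℝ :=
  (1 / (m : ℝ)) • ∑ j ∈ Finset.Ioc a m, (diagonal (fun i => ((j : ℝ) / m) ^ θ i)
    * rescaledRe d₀ n j (F (fourierFreq n j)) * diagonal (fun i => ((j : ℝ) / m) ^ θ i))

section finite

variable {q : ℕ} {d₀ : Fin q → ℝ} {n m : ℕ} {F : ℝ → Matrix (Fin q) (Fin q) ℂ}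

theorem tailMatrix_apply (a : ℕ) (θ : Fin q → ℝ) (r s : Fin q) :
    tailMatrix d₀ n m a F θ r s = 1 / (m : ℝ) * ∑ j ∈ Finset.Ioc a m,
      ((j : ℝ) / m) ^ (θ r + θ s) * rescaledRe d₀ n j (F (fourierFreq n j)) r s := by
  rw [tailMatrix, Matrix.smul_apply, Matrix.sum_apply, smul_eq_mul]
  congr 1
  refine Finset.sum_congr rfl fun j hj => ?_
  rw [Finset.mem_Ioc] at hj
  have h1 : (0 : ℝ) < j := by exact_mod_cast (Nat.zero_le a).trans_lt hj.1
  have h2 : (0 : ℝ) < m := h1.trans_le (by exact_mod_cast hj.2)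
  rw [mul_diagonal, diagonal_mul, Real.rpow_add (by positivity)]
  ring

theorem Ghat_apply (hn : 1 ≤ n) (θ : Fin q → ℝ) (r s : Fin q) :
    Ghat n m F (d₀ + θ) r s = 1 / (m : ℝ) * ∑ j ∈ Finset.Icc 1 m,
      fourierFreq n j ^ (θ r + θ s) * rescaledRe d₀ n j (F (fourierFreq n j)) r s := by
  rw [Ghat, Matrix.smul_apply, Matrix.sum_apply, smul_eq_mul]
  congr 1
  refine Finset.sum_congr rfl fun j hj => ?_
  have hpos := fourierFreq_pos hn (Finset.mem_Icc.1 hj).1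
  rw [rescaledRe, map_apply, map_apply, mul_diagonal, diagonal_mul, mul_diagonal, diagonal_mul,
    Real.rpow_add hpos, Pi.add_apply, Pi.add_apply, Real.rpow_add hpos, Real.rpow_add hpos,
    ← Complex.re_ofReal_mul]
  congr 1
  push_cast
  ring

theorem Ghat_eq (hn : 1 ≤ n) (hm : 1 ≤ m) (θ : Fin q → ℝ) :
    Ghat n m F (d₀ + θ) = diagonal (fun i => fourierFreq n m ^ θ i) * tailMatrix d₀ n m 0 F θ
      * diagonal (fun i => fourierFreq n m ^ θ i) := by
  ext r s
  rw [mul_diagonal, diagonal_mul, Ghat_apply hn, tailMatrix_apply]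
  have h : ∀ j ∈ Finset.Icc 1 m,
      fourierFreq n j ^ (θ r + θ s) * rescaledRe d₀ n j (F (fourierFreq n j)) r s
      = fourierFreq n m ^ θ r * fourierFreq n m ^ θ s *
        (((j : ℝ) / m) ^ (θ r + θ s) * rescaledRe d₀ n j (F (fourierFreq n j)) r s) := by
    intro j hj
    rw [fourierFreq_eq_mul_div hm, Real.mul_rpow (fourierFreq_pos hn hm).le (by positivity),
      ← fourierFreq_eq_mul_div hm, Real.rpow_add (fourierFreq_pos hn hm)]
    ring
  rw [Finset.sum_congr rfl h, ← Finset.mul_sum]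
  have h2 : Finset.Icc 1 m = Finset.Ioc 0 m := rfl
  rw [h2]
  ring

theorem det_Ghat (hn : 1 ≤ n) (hm : 1 ≤ m) (θ : Fin q → ℝ) :
    (Ghat n m F (d₀ + θ)).det = (tailMatrix d₀ n m 0 F θ).det
      * Real.exp (2 * ∑ k, θ k * Real.log (fourierFreq n m)) := by
  rw [Ghat_eq hn hm, det_mul, det_mul, det_diagonal]
  have h : ∏ i, fourierFreq n m ^ θ i = Real.exp (∑ k, θ k * Real.log (fourierFreq n m)) := by
    rw [Real.exp_sum]
    refine Finset.prod_congr rfl fun i _ => ?_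
    rw [Real.rpow_def_of_pos (fourierFreq_pos hn hm), mul_comm]
  rw [h, two_mul, Real.exp_add]
  ring

open scoped ComplexOrder in
theorem det_tailMatrix_le
    (hpsd : ∀ j ∈ Finset.Icc 1 m, (F (fourierFreq n j)).PosSemidef) {a : ℕ} (ha : a ≤ m)
    (θ : Fin q → ℝ) :
    (tailMatrix d₀ n m a F θ).det ≤ (tailMatrix d₀ n m 0 F θ).det := by
  have hterm : ∀ j ∈ Finset.Icc 1 m, (diagonal (fun i => ((j : ℝ) / m) ^ θ i)
      * rescaledRe d₀ n j (F (fourierFreq n j))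
      * diagonal (fun i => ((j : ℝ) / m) ^ θ i)).PosSemidef := fun j hj => by
    simpa [diagonal_conjTranspose] using (rescaledRe_posSemidef (d₀ := d₀) (n := n) (j := j)
      (hpsd j hj)).conjTranspose_mul_mul_same (diagonal (fun i => ((j : ℝ) / m) ^ θ i))
  have hsum : ∀ b c, c ≤ m → ((1 / (m : ℝ)) • ∑ j ∈ Finset.Ioc b c,
      (diagonal (fun i => ((j : ℝ) / m) ^ θ i) * rescaledRe d₀ n j (F (fourierFreq n j))
        * diagonal (fun i => ((j : ℝ) / m) ^ θ i))).PosSemidef := fun b c hc => by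
    refine (posSemidef_sum _ fun j hj => hterm j ?_).smul (by positivity)
    rw [Finset.mem_Ioc] at hj
    rw [Finset.mem_Icc]; omega
  have h := det_le_det_add (hsum a m le_rfl) (hsum 0 a ha)
  rwa [← smul_add, add_comm, Finset.sum_Ioc_consecutive _ (Nat.zero_le a) ha] at h

theorem average_log_fourierFreq (hn : 1 ≤ n) (hm : 1 ≤ m) :
    1 / (m : ℝ) * ∑ j ∈ Finset.Icc 1 m, Real.log (fourierFreq n j)
      = Real.log (fourierFreq n m) + 1 / (m : ℝ) * ∑ j ∈ Finset.Icc 1 m, Real.log (j / m) := by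
  have hm0 : (0 : ℝ) < m := by exact_mod_cast hm
  have h : ∀ j ∈ Finset.Icc 1 m, Real.log (fourierFreq n j)
      = Real.log (fourierFreq n m) + Real.log (j / m) := fun j hj => by
    have hj0 : (0 : ℝ) < j := by exact_mod_cast (Finset.mem_Icc.1 hj).1
    rw [fourierFreq_eq_mul_div hm, Real.log_mul (fourierFreq_pos hn hm).ne' (by positivity)]
  rw [Finset.sum_congr rfl h, Finset.sum_add_distrib, Finset.sum_const, Nat.card_Icc]
  simp only [Nat.add_sub_cancel, nsmul_eq_mul]
  field_simp

/-- The comparison of objective values in exponential form; no positivity of `det Ĝ(d)` is needed,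
since the objective is `-∞` where it fails. -/
theorem det_Ghat_le_of_objective_le {d : Fin q → ℝ} (hpos : 0 < (Ghat n m F d₀).det)
    (h : objective n m F d ≤ objective n m F d₀) :
    (Ghat n m F d).det ≤ (Ghat n m F d₀).det * Real.exp (2 * ∑ k, (d k - d₀ k) *
      (1 / (m : ℝ) * ∑ j ∈ Finset.Icc 1 m, Real.log (fourierFreq n j))) := by
  rcases le_or_gt (Ghat n m F d).det 0 with h0 | h0
  · exact h0.trans (by positivity)
  rw [objective, objective, ENNReal.log_ofReal_of_pos hpos, ENNReal.log_ofReal_of_pos h0,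
    ← EReal.coe_sub, ← EReal.coe_sub, EReal.coe_le_coe_iff] at h
  rw [← Real.log_le_log_iff h0 (by positivity), Real.log_mul hpos.ne' (Real.exp_pos _).ne',
    Real.log_exp]
  simp only [sub_mul, Finset.sum_sub_distrib, mul_sub]
  linarith

/-- For a minimiser, the scale `λ_m` cancels from the two sides of the comparison. -/
theorem det_tailMatrix_zero_le_of_objective_le {d : Fin q → ℝ} (hn : 1 ≤ n) (hm : 1 ≤ m)
    (hpos : 0 < (Ghat n m F d₀).det) (h : objective n m F d ≤ objective n m F d₀) :
    (tailMatrix d₀ n m 0 F (d - d₀)).det ≤ (Ghat n m F d₀).det * Real.exp (2 * ∑ k, (d k - d₀ k) *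
      (1 / (m : ℝ) * ∑ j ∈ Finset.Icc 1 m, Real.log (j / m))) := by
  have h1 := det_Ghat_le_of_objective_le hpos h
  have h2 := det_Ghat (F := F) (d₀ := d₀) hn hm (d - d₀)
  rw [add_sub_cancel] at h2
  rw [h2, average_log_fourierFreq hn hm] at h1
  simp only [mul_add, Finset.sum_add_distrib, Real.exp_add, Pi.sub_apply] at h1
  have h3 := Real.exp_pos (2 * ∑ k, (d k - d₀ k) * Real.log (fourierFreq n m))
  refine le_of_mul_le_mul_right ?_ h3
  linarith

end finite

/-! ### Limits under block averaging and consistency -/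

open scoped ComplexOrder in
/-- The consequences of the assumptions used in the consistency proof, along an arbitrary filter:
sample size and bandwidth grow with `m/n → 0`, the spectral matrices are positive semidefinite and
the normalised entries have block averages converging to those of `G₀`. -/
structure BlockAveraging {q : ℕ} {ι : Type*} (l : Filter ι) (n m : ι → ℕ)
    (F : ι → ℝ → Matrix (Fin q) (Fin q) ℂ) (d₀ : Fin q → ℝ) (G₀ : Matrix (Fin q) (Fin q) ℝ) :
    Prop where
  tendsto_n : Tendsto n l atTop
  tendsto_m : Tendsto m l atTop
  tendsto_div : Tendsto (fun i => (m i : ℝ) / n i) l (𝓝 0)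
  posSemidef : ∀ᶠ i in l, ∀ j ∈ Finset.Icc 1 (m i), (F i (fourierFreq (n i) j)).PosSemidef
  block : ∀ x y : ℝ, 0 ≤ x → x < y → y ≤ 1 → ∀ r s, Tendsto (fun i => 1 / (m i : ℂ) *
    ∑ j ∈ Finset.Ioc ⌊x * m i⌋₊ ⌊y * m i⌋₊,
      normalizedEntry d₀ (n i) j (F i (fourierFreq (n i) j)) r s) l
    (𝓝 ((G₀ r s : ℂ) * ((y - x : ℝ) : ℂ)))

namespace BlockAveraging

variable {q : ℕ} {ι : Type*} {l : Filter ι} {n m : ι → ℕ}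
  {F : ι → ℝ → Matrix (Fin q) (Fin q) ℂ} {d₀ : Fin q → ℝ} {G₀ : Matrix (Fin q) (Fin q) ℝ}

theorem mono (h : BlockAveraging l n m F d₀ G₀) {l' : Filter ι} (hl : l' ≤ l) :
    BlockAveraging l' n m F d₀ G₀ where
  tendsto_n := h.tendsto_n.mono_left hl
  tendsto_m := h.tendsto_m.mono_left hl
  tendsto_div := h.tendsto_div.mono_left hl
  posSemidef := h.posSemidef.filter_mono hl
  block x y hx hxy hy r s := (h.block x y hx hxy hy r s).mono_left hl

/-- The diagonal entries have convergent averages and dominate all others. -/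
theorem exists_average_norm_le (h : BlockAveraging l n m F d₀ G₀) (r s : Fin q) :
    ∃ C, ∀ᶠ i in l, 1 / (m i : ℝ) * ∑ j ∈ Finset.Icc 1 (m i),
      ‖normalizedEntry d₀ (n i) j (F i (fourierFreq (n i) j)) r s‖ ≤ C := by
  have hd : ∀ r, Tendsto (fun i => 1 / (m i : ℝ) * ∑ j ∈ Finset.Icc 1 (m i),
      (normalizedEntry d₀ (n i) j (F i (fourierFreq (n i) j)) r r).re) l (𝓝 (G₀ r r)) := by
    intro r
    have h1 := (Complex.continuous_re.tendsto _).comp (h.block 0 1 le_rfl one_pos le_rfl r r)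
    simp only [sub_zero, Complex.ofReal_one, mul_one, Complex.ofReal_re] at h1
    refine h1.congr fun i => ?_
    simp only [Function.comp, zero_mul, Nat.floor_zero, one_mul, Nat.floor_natCast]
    rw [show (1 / (m i : ℂ)) = ((1 / (m i : ℝ) : ℝ) : ℂ) by push_cast; rfl,
      Complex.re_ofReal_mul, Complex.re_sum]
    rfl
  have hlim := (((hd r).add (hd s)).div_const 2)
  refine ⟨(G₀ r r + G₀ s s) / 2 + 1, ?_⟩
  filter_upwards [hlim.eventually_le_const (lt_add_one _), h.posSemidef,
    h.tendsto_n.eventually_ge_atTop 1] with i hi hpsd hn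
  refine le_trans ?_ hi
  rw [← mul_add, ← Finset.sum_add_distrib, mul_div_assoc, Finset.sum_div]
  refine mul_le_mul_of_nonneg_left (Finset.sum_le_sum fun j hj => ?_) (by positivity)
  exact norm_normalizedEntry_le (hpsd j hj) hn (Finset.mem_Icc.1 hj).1 r s

theorem tendsto_fourierFreq (h : BlockAveraging l n m F d₀ G₀) :
    Tendsto (fun i => fourierFreq (n i) (m i)) l (𝓝 0) := by
  have := h.tendsto_div.const_mul (2 * Real.pi)
  rw [mul_zero] at this
  refine this.congr fun i => ?_
  rw [fourierFreq, mul_div_assoc]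

theorem tendsto_block_rescaledRe (h : BlockAveraging l n m F d₀ G₀) (r s : Fin q) (x y : ℝ)
    (hx : 0 ≤ x) (hxy : x < y) (hy : y ≤ 1) :
    Tendsto (fun i => 1 / (m i : ℝ) * ∑ j ∈ Finset.Ioc ⌊x * m i⌋₊ ⌊y * m i⌋₊,
      rescaledRe d₀ (n i) j (F i (fourierFreq (n i) j)) r s) l
      (𝓝 (limitMatrix d₀ G₀ r s * (y - x))) := by
  set e : ℂ := Complex.exp (Complex.I * (Real.pi * (d₀ r - d₀ s) / 2 : ℝ)) with he
  have hmain : Tendsto (fun i => 1 / (m i : ℝ) * ∑ j ∈ Finset.Ioc ⌊x * m i⌋₊ ⌊y * m i⌋₊,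
      (e * normalizedEntry d₀ (n i) j (F i (fourierFreq (n i) j)) r s).re) l
      (𝓝 (limitMatrix d₀ G₀ r s * (y - x))) := by
    have h1 := (Complex.continuous_re.tendsto _).comp ((h.block x y hx hxy hy r s).const_mul e)
    have h2 : (e * ((G₀ r s : ℂ) * ((y - x : ℝ) : ℂ))).re = limitMatrix d₀ G₀ r s * (y - x) := by
      rw [← Complex.ofReal_mul, Complex.re_mul_ofReal, he, mul_comm Complex.I,
        Complex.exp_ofReal_mul_I_re, limitMatrix, of_apply, mul_assoc]
    rw [h2] at h1
    refine h1.congr fun i => ?_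
    simp only [Function.comp]
    rw [show (1 / (m i : ℂ)) = ((1 / (m i : ℝ) : ℝ) : ℂ) by push_cast; rfl, mul_left_comm,
      Complex.re_ofReal_mul, Finset.mul_sum, Complex.re_sum]
  obtain ⟨C, hC⟩ := h.exists_average_norm_le r s
  have hdiff : Tendsto (fun i => 1 / (m i : ℝ) * ∑ j ∈ Finset.Ioc ⌊x * m i⌋₊ ⌊y * m i⌋₊,
      (rescaledRe d₀ (n i) j (F i (fourierFreq (n i) j)) r s
        - (e * normalizedEntry d₀ (n i) j (F i (fourierFreq (n i) j)) r s).re)) l (𝓝 0) := by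
    have hb := (h.tendsto_fourierFreq.mul_const |(d₀ r - d₀ s) / 2|).mul_const C
    rw [zero_mul, zero_mul] at hb
    refine squeeze_zero_norm' ?_ hb
    filter_upwards [hC, h.tendsto_n.eventually_ge_atTop 1, h.tendsto_m.eventually_ge_atTop 1]
      with i hCi hn hm
    have hsub : ∀ j ∈ Finset.Ioc ⌊x * m i⌋₊ ⌊y * m i⌋₊, j ∈ Finset.Icc 1 (m i) := by
      intro j hj
      rw [Finset.mem_Ioc] at hj
      rw [Finset.mem_Icc]
      have h1 : ⌊y * m i⌋₊ ≤ m i := Nat.floor_le_of_le (mul_le_of_le_one_left (by positivity) hy)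
      omega
    have hf := (fourierFreq_pos hn hm).le
    rw [norm_mul, Real.norm_of_nonneg (by positivity)]
    calc _ ≤ 1 / (m i : ℝ) * ∑ j ∈ Finset.Ioc ⌊x * m i⌋₊ ⌊y * m i⌋₊,
          fourierFreq (n i) (m i) * |(d₀ r - d₀ s) / 2| *
            ‖normalizedEntry d₀ (n i) j (F i (fourierFreq (n i) j)) r s‖ := by
          refine mul_le_mul_of_nonneg_left ?_ (by positivity)
          refine (norm_sum_le _ _).trans (Finset.sum_le_sum fun j hj => ?_)
          have hj' := Finset.mem_Icc.1 (hsub j hj)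
          refine (abs_rescaledRe_sub_le hn hj'.1 r s).trans ?_
          have := fourierFreq_mono (n := n i) hj'.2
          gcongr
      _ ≤ 1 / (m i : ℝ) * ∑ j ∈ Finset.Icc 1 (m i),
          fourierFreq (n i) (m i) * |(d₀ r - d₀ s) / 2| *
            ‖normalizedEntry d₀ (n i) j (F i (fourierFreq (n i) j)) r s‖ := by
          refine mul_le_mul_of_nonneg_left ?_ (by positivity)
          exact Finset.sum_le_sum_of_subset_of_nonneg hsub fun _ _ _ => by positivity
      _ = fourierFreq (n i) (m i) * |(d₀ r - d₀ s) / 2| * (1 / (m i : ℝ) *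
          ∑ j ∈ Finset.Icc 1 (m i),
            ‖normalizedEntry d₀ (n i) j (F i (fourierFreq (n i) j)) r s‖) := by
          rw [← Finset.mul_sum]; ring
      _ ≤ _ := mul_le_mul_of_nonneg_left hCi (by positivity)
  have h3 := hmain.add hdiff
  rw [add_zero] at h3
  refine h3.congr fun i => ?_
  rw [← mul_add, ← Finset.sum_add_distrib]
  congr 1
  exact Finset.sum_congr rfl fun j _ => by ring

theorem tendsto_det_Ghat (h : BlockAveraging l n m F d₀ G₀) :
    Tendsto (fun i => (Ghat (n i) (m i) (F i) d₀).det) l (𝓝 (limitMatrix d₀ G₀).det) := by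
  refine ((continuous_id.matrix_det).tendsto (limitMatrix d₀ G₀)).comp ?_
  refine tendsto_pi_nhds.2 fun r => tendsto_pi_nhds.2 fun s => ?_
  have h1 := h.tendsto_block_rescaledRe r s 0 1 le_rfl one_pos le_rfl
  rw [sub_zero, mul_one] at h1
  refine h1.congr' ?_
  filter_upwards [h.tendsto_n.eventually_ge_atTop 1] with i hn
  have h2 := Ghat_apply (F := F i) (m := m i) (d₀ := d₀) hn 0 r s
  simp only [add_zero, Pi.zero_apply, Real.rpow_zero, one_mul] at h2
  refine Eq.trans ?_ h2.symm
  simp only [zero_mul, Nat.floor_zero, one_mul, Nat.floor_natCast]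
  rfl

theorem tendsto_det_tailMatrix (h : BlockAveraging l n m F d₀ G₀) {θ : ι → Fin q → ℝ}
    {θ₀ : Fin q → ℝ} (hθ : Tendsto θ l (𝓝 θ₀)) {κ : ℝ} (hκ : κ ∈ Set.Ioo (0 : ℝ) 1) :
    Tendsto (fun i => (tailMatrix d₀ (n i) (m i) ⌊κ * m i⌋₊ (F i) (θ i)).det) l
      (𝓝 (of fun r s => limitMatrix d₀ G₀ r s * momentMatrix κ θ₀ r s).det) := by
  refine ((continuous_id.matrix_det).tendsto
    (of fun r s => limitMatrix d₀ G₀ r s * momentMatrix κ θ₀ r s)).comp ?_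
  refine tendsto_pi_nhds.2 fun r => tendsto_pi_nhds.2 fun s => ?_
  obtain ⟨C, hC⟩ := h.exists_average_norm_le r s
  have hbound : ∀ᶠ i in l, 1 / (m i : ℝ) * ∑ j ∈ Finset.Icc 1 (m i),
      |rescaledRe d₀ (n i) j (F i (fourierFreq (n i) j)) r s| ≤ C := by
    filter_upwards [hC, h.tendsto_n.eventually_ge_atTop 1] with i hCi hn
    refine le_trans (mul_le_mul_of_nonneg_left (Finset.sum_le_sum fun j hj => ?_)
      (by positivity)) hCi
    exact abs_rescaledRe_le hn (Finset.mem_Icc.1 hj).1 r s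
  have hcont : ContinuousOn (fun x : ℝ => x ^ (θ₀ r + θ₀ s)) (Set.Icc κ 1) := fun x hx =>
    (Real.continuousAt_rpow_const _ _ (Or.inl (hκ.1.trans_le hx.1).ne')).continuousWithinAt
  have hlim := tendsto_average_mul_tendstoUniformlyOn hbound (h.tendsto_block_rescaledRe r s)
    h.tendsto_m hκ.1.le hκ.2 hcont (tendstoUniformlyOn_rpow hκ.1
      (((tendsto_pi_nhds.1 hθ) r).add ((tendsto_pi_nhds.1 hθ) s)))
  exact hlim.congr fun i => (tailMatrix_apply _ (θ i) r s).symm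

/-- Every limit of minimisers is the true parameter. -/
theorem eq_of_tendsto_of_objective_le [l.NeBot] (h : BlockAveraging l n m F d₀ G₀)
    (hG₀ : G₀.PosDef) (hd₀ : ∀ k, d₀ k ∈ Set.Ioo (-(1 / 2) : ℝ) (1 / 2)) {d : ι → Fin q → ℝ}
    {d' : Fin q → ℝ} (hd : Tendsto d l (𝓝 d')) (hd' : ∀ k, -(1 / 2) ≤ d' k)
    (hmin : ∀ᶠ i in l, objective (n i) (m i) (F i) (d i) ≤ objective (n i) (m i) (F i) d₀) :
    d' = d₀ := by
  have hpos := (limitMatrix_posDef hG₀ hd₀).det_pos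
  rw [← sub_eq_zero]
  refine eq_zero_of_prod_integral_rpow_le_one (fun r => ?_) fun κ hκ => ?_
  · rw [Pi.sub_apply]
    linarith [hd' r, (hd₀ r).2]
  have hθ : Tendsto (fun i => d i - d₀) l (𝓝 (d' - d₀)) := hd.sub_const d₀
  have hright : Tendsto (fun i => (Ghat (n i) (m i) (F i) d₀).det *
      Real.exp (2 * ∑ k, (d i k - d₀ k) * (1 / (m i : ℝ) *
        ∑ j ∈ Finset.Icc 1 (m i), Real.log (j / m i)))) l
      (𝓝 ((limitMatrix d₀ G₀).det * Real.exp (2 * ∑ k, (d' k - d₀ k) * (-1)))) := by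
    refine h.tendsto_det_Ghat.mul ((Real.continuous_exp.tendsto _).comp
      (Tendsto.const_mul _ (tendsto_finsetSum _ fun k _ => ?_)))
    exact ((tendsto_pi_nhds.1 hθ) k).mul (tendsto_average_log_div.comp h.tendsto_m)
  have hle := le_of_tendsto_of_tendsto (h.tendsto_det_tailMatrix hθ hκ) hright (by
    filter_upwards [hmin, h.posSemidef, h.tendsto_n.eventually_ge_atTop 1,
      h.tendsto_m.eventually_ge_atTop 1, h.tendsto_det_Ghat.eventually_const_lt hpos]
      with i hi hpsd hn hm hdet
    refine (det_tailMatrix_le hpsd ?_ _).trans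
      (det_tailMatrix_zero_le_of_objective_le hn hm hdet hi)
    exact Nat.floor_le_of_le (mul_le_of_le_one_left (by positivity) hκ.2.le))
  have hopp := (det_mul_prod_diag_le_det_hadamard (limitMatrix_posDef hG₀ hd₀)
    (momentMatrix_posSemidef hκ (d' - d₀)) (momentMatrix_diag_pos hκ _)).trans hle
  have h1 := le_of_mul_le_mul_left hopp hpos
  rw [Finset.prod_mul_distrib, ← Real.exp_sum, ← Finset.mul_sum]
  calc _ ≤ Real.exp (2 * ∑ k, (d' k - d₀ k) * (-1)) * Real.exp (2 * ∑ k, (d' - d₀) k) :=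
        mul_le_mul_of_nonneg_right h1 (Real.exp_pos _).le
    _ = 1 := by
        rw [← Real.exp_add, ← Finset.sum_mul, ← mul_add, mul_neg_one]
        simp only [Pi.sub_apply, neg_add_cancel, mul_zero, Real.exp_zero]

/-- Consistency along an arbitrary filter: by compactness every ultrafilter has a limit of the
minimisers, and that limit is `d₀`. -/
theorem tendsto_of_objective_le (h : BlockAveraging l n m F d₀ G₀)
    (hG₀ : G₀.PosDef) (hd₀ : ∀ k, d₀ k ∈ Set.Ioo (-(1 / 2) : ℝ) (1 / 2)) {d : ι → Fin q → ℝ}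
    (hd : ∀ᶠ i in l, ∀ k, d i k ∈ Set.Ioo (-(1 / 2) : ℝ) (1 / 2))
    (hmin : ∀ᶠ i in l, objective (n i) (m i) (F i) (d i) ≤ objective (n i) (m i) (F i) d₀) :
    Tendsto d l (𝓝 d₀) := by
  rw [tendsto_iff_ultrafilter]
  intro U hU
  have hcomp : IsCompact (Set.pi Set.univ fun _ : Fin q => Set.Icc (-(1 / 2) : ℝ) (1 / 2)) :=
    isCompact_univ_pi fun _ => isCompact_Icc
  obtain ⟨d', hd'K, hd'⟩ := hcomp.ultrafilter_le_nhds (U.map d) (by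
    rw [le_principal_iff, Ultrafilter.mem_coe, Ultrafilter.mem_map]
    filter_upwards [hd.filter_mono hU] with i hi k _
    exact Set.Ioo_subset_Icc_self (hi k))
  have heq : d' = d₀ := (h.mono hU).eq_of_tendsto_of_objective_le hG₀ hd₀ hd'
    (fun k => (hd'K k trivial).1) (hmin.filter_mono hU)
  rw [← heq]
  exact hd'

end BlockAveraging

/-- The averaged condition, applied with `u = ⌊xm⌋ + 1` and `v = ⌊ym⌋`, gives the limits of all
block averages. -/
theorem AveragedCondition.tendsto_block {Ω : Type*} [MeasurableSpace Ω] {μ : Measure Ω} {q : ℕ}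
    {fn : ℕ → Ω → ℝ → Matrix (Fin q) (Fin q) ℂ} {m : ℕ → ℕ} {d₀ : Fin q → ℝ}
    {G₀ : Matrix (Fin q) (Fin q) ℝ} (hcond : AveragedCondition μ fn m d₀ G₀)
    (hm : Tendsto m atTop atTop) {x y : ℝ} (hx : 0 ≤ x) (hxy : x < y) (hy : y ≤ 1) (r s : Fin q) :
    Tendsto (fun z : ℕ × Ω => 1 / (m z.1 : ℂ) * ∑ j ∈ Finset.Ioc ⌊x * m z.1⌋₊ ⌊y * m z.1⌋₊,
      normalizedEntry d₀ z.1 j (fn z.1 z.2 (fourierFreq z.1 j)) r s) (probFilter μ)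
      (𝓝 ((G₀ r s : ℂ) * ((y - x : ℝ) : ℂ))) := by
  have hmR : Tendsto (fun n => (m n : ℝ)) atTop atTop := tendsto_natCast_atTop_atTop.comp hm
  have hfl : ∀ c : ℝ, 0 ≤ c → Tendsto (fun n => (⌊c * m n⌋₊ : ℝ) / m n) atTop (𝓝 c) :=
    fun c hc => (tendsto_nat_floor_mul_div_atTop hc).comp hmR
  have hlen : Tendsto (fun n => ((⌊y * m n⌋₊ : ℝ) - ⌊x * m n⌋₊) / m n) atTop (𝓝 (y - x)) := by
    simpa only [sub_div] using (hfl y (hx.trans hxy.le)).sub (hfl x hx)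
  have huv : ∀ᶠ n in atTop, 1 ≤ ⌊x * m n⌋₊ + 1 ∧ ⌊x * m n⌋₊ + 1 < ⌊y * m n⌋₊ ∧
      ⌊y * m n⌋₊ ≤ m n := by
    filter_upwards [hmR.eventually_ge_atTop (3 / (y - x))] with n hn
    rw [div_le_iff₀ (by linarith)] at hn
    refine ⟨by omega, ?_, Nat.floor_le_of_le (mul_le_of_le_one_left (by positivity) hy)⟩
    have h1 : (⌊x * m n⌋₊ : ℝ) ≤ x * m n := Nat.floor_le (by positivity)
    have h2 : y * m n < ⌊y * m n⌋₊ + 1 := Nat.lt_floor_add_one _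
    have h3 : ((⌊x * m n⌋₊ + 1 : ℕ) : ℝ) < (⌊y * m n⌋₊ : ℕ) := by
      push_cast
      nlinarith
    exact_mod_cast h3
  have h1 := tendstoInMeasure_const_iff.1 (hcond _ _ huv r s)
  have h2 : Tendsto (fun z : ℕ × Ω => (G₀ r s : ℂ) *
      ((((⌊y * m z.1⌋₊ : ℝ) - ⌊x * m z.1⌋₊) / m z.1 : ℝ) : ℂ)) (probFilter μ)
      (𝓝 ((G₀ r s : ℂ) * ((y - x : ℝ) : ℂ))) :=
    ((Complex.continuous_ofReal.tendsto _).comp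
      (hlen.comp (tendsto_fst_probFilter μ))).const_mul _
  have h3 := h1.add h2
  rw [zero_add] at h3
  refine h3.congr' ?_
  filter_upwards [(tendsto_fst_probFilter μ).eventually huv] with z hz
  have hicc : Finset.Icc (⌊x * m z.1⌋₊ + 1) ⌊y * m z.1⌋₊
      = Finset.Ioc ⌊x * m z.1⌋₊ ⌊y * m z.1⌋₊ := by
    ext j
    rw [Finset.mem_Icc, Finset.mem_Ioc, Nat.succ_le_iff]
  rw [hicc, Finset.sum_sub_distrib, Finset.sum_const, Nat.card_Ioc, nsmul_eq_mul,
    Nat.cast_sub (by omega)]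
  push_cast
  ring

end LongMemory

theorem theorem3p2 {Ω : Type*} [MeasurableSpace Ω] (μ : Measure Ω) [IsProbabilityMeasure μ]
    (q : ℕ) (X : ℕ → Ω → Fin q → ℝ) (f : ℝ → Matrix (Fin q) (Fin q) ℂ)
    (hX : LongMemory.IsWeaklyStationary μ X) (hf : LongMemory.IsSpectralDensity μ X f)
    (G₀ : Matrix (Fin q) (Fin q) ℝ) (hG₀ : G₀.PosDef)
    (Θ : Set (Fin q → ℝ)) (hΘ : ∀ d ∈ Θ, ∀ k, d k ∈ Set.Ioo (-(1 / 2) : ℝ) (1 / 2))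
    (d₀ : Fin q → ℝ) (hd₀ : d₀ ∈ Θ)
    (A : ℕ → Matrix (Fin q) (Fin q) ℝ) (ε : ℤ → Ω → Fin q → ℝ) (m : ℕ → ℕ)
    (hA1 : LongMemory.AssumptionA1 f d₀ G₀) (hA2 : LongMemory.AssumptionA2 μ X A ε)
    (hA3 : LongMemory.AssumptionA3 A) (hA4 : LongMemory.AssumptionA4 m)
    (est : LongMemory.SpectralEstimator q)
    (hpsd : LongMemory.IsAsymptoticallyPosSemidef μ (LongMemory.evalEstimator est X) m)
    (hcond : LongMemory.AveragedCondition μ (LongMemory.evalEstimator est X) m d₀ G₀)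
    (dhat : ℕ → Ω → Fin q → ℝ)
    (hdhat : LongMemory.IsArgminEstimator μ (LongMemory.evalEstimator est X) m Θ dhat) :
    TendstoInMeasure μ dhat atTop (fun _ => d₀) := by
  have hblock : LongMemory.BlockAveraging (LongMemory.probFilter μ) Prod.fst (fun z => m z.1)
      (fun z => LongMemory.evalEstimator est X z.1 z.2) d₀ G₀ :=
    { tendsto_n := LongMemory.tendsto_fst_probFilter μ
      tendsto_m := hA4.1.comp (LongMemory.tendsto_fst_probFilter μ)
      tendsto_div := hA4.2.comp (LongMemory.tendsto_fst_probFilter μ)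
      posSemidef := LongMemory.eventually_probFilter.2 hpsd
      block := fun _ _ hx hxy hy r s => hcond.tendsto_block hA4.1 hx hxy hy r s }
  have hargmin := LongMemory.eventually_probFilter_of_ae (p := fun z => dhat z.1 z.2 ∈ Θ ∧
    ∀ d ∈ Θ, LongMemory.objective z.1 (m z.1) (LongMemory.evalEstimator est X z.1 z.2)
      (dhat z.1 z.2) ≤ LongMemory.objective z.1 (m z.1)
      (LongMemory.evalEstimator est X z.1 z.2) d) hdhat
  exact LongMemory.tendstoInMeasure_const_iff.2 (hblock.tendsto_of_objective_le hG₀ (hΘ d₀ hd₀)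
    (hargmin.mono fun z hz => hΘ _ hz.1) (hargmin.mono fun z hz => hz.2 d₀ hd₀))
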